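/- \textbf{Setting.} For $i\in\{1,2\}$ let $G_i=\langle X_i\mid R_i\rangle$ be a finite group given by a finite presentation, $X_1^{\pm}\cap X_2^{\pm}=\emptyset$, let $\phi_i:A\to G_i$ be monomorphisms from a group $A$, and let $G=G_1*_AG_2$ be the amalgam. $A$ is identified with its images in $G_1,G_2,G$. Put $X=X_1\cup X_2$. A graph labelled with $X^{\pm}$ has vertices and directed edges; each edge $e$ has an initial vertex $\iota(e)$, a reverse edge $\bar e\ne e$ and a label with $lab(\bar e)=lab(e)^{-1}$; $\tau(e)=\iota(\bar e)$. It is well-labelled if two edges with the same initial vertex and label coincide. $Lab(\Gamma,v_0)\le G$ is the set of elements represented by labels of paths closed at $v_0$. An $X_i$-monochromatic component is a maximal connected subgraph labelled by $X_i^{\pm}$ with at least one edge. A vertex is bichromatic if edges with labels in $X_1^{\pm}$ and in $X_2^{\pm}$ start at it, and $X_i$-monochromatic if all edges that start at it have labels in $X_i^{\pm}$; $VB(C)$ and $VM_i(C)$ denote the vertices of $C$ that are bichromatic, respectively $X_i$-monochromatic, in $\Gamma$. For $S\le G_i$, $Cayley(G_i,S)$ has as vertices the right cosets $Sg$ and an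 edge labelled $x$ from $Sg$ to $Sgx$ for each $x\in X_i^{\pm}$; $Cayley(G_i)$ is the case $S=1$. A \emph{precover} of $G$ is a connected labelled graph in which every path whose label is trivial in $G$ is closed and each $X_i$-monochromatic component is isomorphic to some $Cayley(G_i,S)$. A monochromatic component $C$ of colour $i$ of a precover $(\Gamma,v_0)$ is \emph{redundant} if either (1) it is the only monochromatic component and $Lab(C,v_0)=1$, or (2) there are at least two monochromatic components and, for a vertex $\vartheta\in VB(C)$ and $K=Lab(C,\vartheta)$: $K\le A$, $VB(C)=\vartheta\cdot A$, and either $v_0\notin V(C)$, or $v_0\in VB(C)$ and $K=1$. A precover is \emph{reduced} if it has no redundant component and, whenever $v_0$ lies in a component $C$ of one colour with $Lab(C,v_0)\cap A\ne 1$, it lies in a component $D$ of the other colour with $Lab(C,v_0)\cap A=Lab(D,v_0)\cap A$. \textbf{Generalized Stallings algorithm.} Input: finitely many words $w_1,\dots,w_n$ over $X^{\pm}$ ($n\ge 0$); $H\le G$ is the subgroup generated by the elements they represent. A folding identifies two distinct edges with the same initial vertex and the same label. \begin{enumerate} \item $\Gamma_1$ is the bouquet of $n$ loops at $v_0$ labelled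 $w_1,\dots,w_n$. \item Fold edges and cut hairs (remove an edge whose terminal vertex is different from $v_0$ and has degree one, together with that vertex) as long as possible; the result is $\Gamma_2$. \item For each $X_i$-monochromatic component of $\Gamma_2$ ($i=1,2$), pick an edge $e$ of it, glue a copy of $Cayley(G_i)$ to the current graph by identifying $e$ with the edge of $Cayley(G_i)$ that starts at $1$ and has the same label, and fold as long as possible. The result is $\Gamma_3$. \item As long as possible, in any order: for a vertex $v\in VB(\Gamma_3)$ (more precisely its image in the current graph) and paths $p_1,p_2$ from $v$, labelled in $X_1^{\pm}$ and $X_2^{\pm}$ respectively, with $lab(p_1)=_Glab(p_2)\in A$ and $\tau(p_1)\ne\tau(p_2)$, identify $\tau(p_1)$ with $\tau(p_2)$; and fold edges. The result is $\Gamma_4$. \item As long as possible, remove (all edges and all $X_i$-monochromatic vertices of) an $X_i$-monochromatic component $C$ such that, for some $\vartheta\in VB(C)$ and $K\le A\cap G_i$, $(C,\vartheta)\cong(Cayley(G_i,K),K\cdot1)$, $|VB(C)|=[A:K]$, and either $K=1$ and $v_0\notin VM_i(C)$, or $K\neq1$ and $v_0\notin V(C)$. If the resulting graph $\Gamma$ has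 no bichromatic vertex and $(\Gamma,v_0)\cong (Cayley(G_i),1)$ for some $i$, let $\Gamma_5$ consist of the single vertex $v_0$ and no edges; otherwise $\Gamma_5=\Gamma$. \item If $v_0$ is an $X_i$-monochromatic vertex of $\Gamma_5$ that lies in an $X_i$-monochromatic component $C$ with $(C,v_0)\cong(Cayley(G_i,K),K\cdot 1)$ and $L=K\cap A\neq1$, glue $Cayley(G_j,L)$, $j\ne i$, to $\Gamma_5$ by identifying $L\cdot a$ with $v_0\cdot a$ for all $a\in A$. The result, or $\Gamma_5$ if the condition fails, is the output $(\Gamma(H),v_0)$. \end{enumerate} \textbf{Lemma.} For every input and whatever choices are made, the algorithm terminates (every execution is finite and does not stop before it has produced an output), and its output $(\Gamma(H),v_0)$ is a finite graph that is a reduced precover of $G$ with $Lab(\Gamma(H),v_0)=H$. -/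

import Mathlib

universe u v

namespace Stallings

/-! ## Labelled graphs

Throughout `X 0` and `X 1` are the (disjoint) generating sets of the two factors; the alphabet
is the disjoint union `Σ i, X i` together with formal inverses. -/

section Graphs

/-- The signed alphabet: `(⟨i, x⟩, true)` is `x ∈ X i` and `(⟨i, x⟩, false)` is its formal
inverse (the convention of `FreeGroup`). -/
abbrev Letter (X : Fin 2 → Type u) : Type u := (Σ i, X i) × Bool

variable {X : Fin 2 → Type u}

/-- The formal inverse of a letter. -/
def Letter.inv (l : Letter X) : Letter X := (l.1, !l.2)

/-- The index `i` such that the letter belongs to `X i` or to the inverses of `X i`. -/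
def Letter.color (l : Letter X) : Fin 2 := l.1.1

/-- A graph labelled with the signed alphabet: every edge `e` has an initial vertex `ini e`,
a reverse edge `rev e` and a label. That `rev e ≠ e` follows from the last axiom,
see `LGraph.rev_ne`. -/
structure LGraph (X : Fin 2 → Type u) where
  V : Type u
  E : Type u
  ini : E → V
  rev : E → E
  lab : E → Letter X
  rev_rev : ∀ e, rev (rev e) = e
  lab_rev : ∀ e, lab (rev e) = (lab e).inv

/-- A labelled graph with a basepoint. -/
structure PGraph (X : Fin 2 → Type u) extends LGraph X where
  base : V

namespace LGraph

variable (Γ : LGraph X)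

theorem rev_ne (e : Γ.E) : Γ.rev e ≠ e := by
  intro h
  have h1 := congrArg Prod.snd (Γ.lab_rev e)
  rw [h] at h1
  simp [Letter.inv] at h1

/-- The terminal vertex of an edge. -/
def ter (e : Γ.E) : Γ.V := Γ.ini (Γ.rev e)

/-- The colour (`0` or `1`) of an edge. -/
def color (e : Γ.E) : Fin 2 := (Γ.lab e).color

theorem color_rev (e : Γ.E) : Γ.color (Γ.rev e) = Γ.color e := by
  simp [color, Γ.lab_rev, Letter.inv, Letter.color]

/-- `Γ.HasPath a w b`: there is a path in `Γ` from `a` to `b` with label the word `w`. -/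
inductive HasPath : Γ.V → List (Letter X) → Γ.V → Prop
  | nil (a : Γ.V) : HasPath a [] a
  | cons (e : Γ.E) {w : List (Letter X)} {b : Γ.V} (h : HasPath (Γ.ter e) w b) :
      HasPath (Γ.ini e) (Γ.lab e :: w) b

/-- There is a path from `a` to `b` with label `w`, all of whose edges have colour `i`. -/
def HasMonoPath (i : Fin 2) (a : Γ.V) (w : List (Letter X)) (b : Γ.V) : Prop :=
  Γ.HasPath a w b ∧ ∀ l ∈ w, l.color = i

theorem HasPath.snoc {Γ : LGraph X} {a b : Γ.V} {w : List (Letter X)} (h : Γ.HasPath a w b)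
    (e : Γ.E) (he : Γ.ini e = b) : Γ.HasPath a (w ++ [Γ.lab e]) (Γ.ter e) := by
  induction h with
  | nil a => subst he; exact HasPath.cons e (HasPath.nil _)
  | cons f _ ih => exact HasPath.cons f (ih he)

/-- Any two vertices are joined by a path (and there is a vertex). -/
def Connected : Prop := Nonempty Γ.V ∧ ∀ a b : Γ.V, ∃ w, Γ.HasPath a w b

/-- No two distinct edges have the same initial vertex and the same label. -/
def WellLabelled : Prop :=
  ∀ e f : Γ.E, Γ.ini e = Γ.ini f → Γ.lab e = Γ.lab f → e = f

/-- The number of edges that start at a vertex. -/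
noncomputable def degree (a : Γ.V) : ℕ := {e : Γ.E | Γ.ini e = a}.ncard

/-- Edges of both colours start at `a`. -/
def Bichromatic (a : Γ.V) : Prop := ∀ i : Fin 2, ∃ e, Γ.ini e = a ∧ Γ.color e = i

/-- The set of bichromatic vertices. -/
def VB : Set Γ.V := {a | Γ.Bichromatic a}

/-- All edges that start at `a` have colour `i`. -/
def Monochromatic (i : Fin 2) (a : Γ.V) : Prop := ∀ e, Γ.ini e = a → Γ.color e = i

/-! ### Monochromatic components

A monochromatic component is a maximal connected subgraph all of whose edges have the same colour
and which has at least one edge. It is the component of any of its edges `e`. -/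

/-- The vertices of the monochromatic component of the edge `e`. -/
def compV (e : Γ.E) : Set Γ.V := {a | ∃ w, Γ.HasMonoPath (Γ.color e) (Γ.ini e) w a}

/-- The edges of the monochromatic component of the edge `e`. -/
def compE (e : Γ.E) : Set Γ.E := {f | Γ.color f = Γ.color e ∧ Γ.ini f ∈ Γ.compV e}

theorem rev_mem_compE {Γ : LGraph X} {e f : Γ.E} (hf : f ∈ Γ.compE e) :
    Γ.rev f ∈ Γ.compE e := by
  obtain ⟨hc, w, hw, hl⟩ := hf
  refine ⟨by rw [Γ.color_rev, hc], w ++ [Γ.lab f], hw.snoc f rfl, ?_⟩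
  intro l hmem
  rcases List.mem_append.1 hmem with h | h
  · exact hl l h
  · rw [List.mem_singleton.1 h]; exact hc

/-- The monochromatic component of the edge `e`, as a labelled graph. -/
def comp (e : Γ.E) : LGraph X where
  V := Γ.compV e
  E := Γ.compE e
  ini f := ⟨Γ.ini f.1, f.2.2⟩
  rev f := ⟨Γ.rev f.1, rev_mem_compE f.2⟩
  lab f := Γ.lab f.1
  rev_rev f := Subtype.ext (Γ.rev_rev f.1)
  lab_rev f := Γ.lab_rev f.1

/-- The bichromatic vertices of `Γ` that lie in the monochromatic component of `e`. -/
def compVB (e : Γ.E) : Set Γ.V := Γ.compV e ∩ Γ.VB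

/-- The vertices of the monochromatic component of `e` that are monochromatic in `Γ`
(of the colour of `e`). -/
def compVM (e : Γ.E) : Set Γ.V := {a | a ∈ Γ.compV e ∧ Γ.Monochromatic (Γ.color e) a}

/-- An isomorphism of labelled graphs. -/
structure Iso (Γ Δ : LGraph X) where
  onV : Γ.V ≃ Δ.V
  onE : Γ.E ≃ Δ.E
  ini_onE : ∀ e, Δ.ini (onE e) = onV (Γ.ini e)
  rev_onE : ∀ e, Δ.rev (onE e) = onE (Γ.rev e)
  lab_onE : ∀ e, Δ.lab (onE e) = Γ.lab e

/-! ### Operations on labelled graphs -/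

/-- The disjoint union of two labelled graphs. -/
def disjUnion (Γ Δ : LGraph X) : LGraph X where
  V := Γ.V ⊕ Δ.V
  E := Γ.E ⊕ Δ.E
  ini := Sum.map Γ.ini Δ.ini
  rev := Sum.map Γ.rev Δ.rev
  lab := Sum.elim Γ.lab Δ.lab
  rev_rev e := by cases e <;> simp [LGraph.rev_rev]
  lab_rev e := by cases e <;> simp [LGraph.lab_rev]

/-- The relation on vertices generating the identification of the edges `e` and `f`. -/
def EdgeRelV (e f : Γ.E) (a b : Γ.V) : Prop :=
  (a = Γ.ini e ∧ b = Γ.ini f) ∨ (a = Γ.ter e ∧ b = Γ.ter f)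

/-- The relation on edges generating the identification of the edges `e` and `f`. -/
def EdgeRelE (e f : Γ.E) (a b : Γ.E) : Prop :=
  (a = e ∧ b = f) ∨ (a = Γ.rev e ∧ b = Γ.rev f)

/-- The graph obtained by identifying two edges with the same label (together with their
reverse edges, their initial vertices and their terminal vertices). -/
def identEdges (e f : Γ.E) (h : Γ.lab e = Γ.lab f) : LGraph X where
  V := Quot (Γ.EdgeRelV e f)
  E := Quot (Γ.EdgeRelE e f)
  ini := Quot.map Γ.ini (by
    rintro a b (⟨rfl, rfl⟩ | ⟨rfl, rfl⟩)
    · exact Or.inl ⟨rfl, rfl⟩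
    · exact Or.inr ⟨rfl, rfl⟩)
  rev := Quot.map Γ.rev (by
    rintro a b (⟨rfl, rfl⟩ | ⟨rfl, rfl⟩)
    · exact Or.inr ⟨rfl, rfl⟩
    · exact Or.inl ⟨Γ.rev_rev _, Γ.rev_rev _⟩)
  lab := Quot.lift Γ.lab (by
    rintro a b (⟨rfl, rfl⟩ | ⟨rfl, rfl⟩)
    · exact h
    · rw [Γ.lab_rev, Γ.lab_rev, h])
  rev_rev e := by
    induction e using Quot.ind with
    | mk e => exact congrArg (Quot.mk _) (Γ.rev_rev e)
  lab_rev e := by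
    induction e using Quot.ind with
    | mk e => exact Γ.lab_rev e

/-- The graph obtained by identifying vertices that are related by `r`; the edges are kept. -/
def identVerts (r : Γ.V → Γ.V → Prop) : LGraph X where
  V := Quot r
  E := Γ.E
  ini e := Quot.mk r (Γ.ini e)
  rev := Γ.rev
  lab := Γ.lab
  rev_rev := Γ.rev_rev
  lab_rev := Γ.lab_rev

end LGraph

namespace PGraph

variable (Γ : PGraph X)

/-- The pair `e`, `f` can be folded: distinct edges with the same initial vertex and label. -/
structure Foldable (e f : Γ.E) : Prop where
  ne : e ≠ f
  ini_eq : Γ.ini e = Γ.ini f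
  lab_eq : Γ.lab e = Γ.lab f

/-- Stallings' folding of the edges `e` and `f`. -/
def fold (e f : Γ.E) (h : Γ.Foldable e f) : PGraph X :=
  { Γ.identEdges e f h.lab_eq with base := Quot.mk _ Γ.base }

/-- The image of an edge under a folding. -/
def foldE (e f : Γ.E) (h : Γ.Foldable e f) (a : Γ.E) : (Γ.fold e f h).E := Quot.mk _ a

/-- The image of a vertex under a folding. -/
def foldV (e f : Γ.E) (h : Γ.Foldable e f) (a : Γ.V) : (Γ.fold e f h).V := Quot.mk _ a

/-- The edge `e` is a hair: its terminal vertex is not the basepoint and has degree one. -/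
structure IsHair (e : Γ.E) : Prop where
  degree_eq : Γ.degree (Γ.ter e) = 1
  ter_ne : Γ.ter e ≠ Γ.base

theorem IsHair.eq_rev {Γ : PGraph X} {e : Γ.E} (h : Γ.IsHair e) {f : Γ.E}
    (hf : Γ.ini f = Γ.ter e) : f = Γ.rev e := by
  obtain ⟨g, hg⟩ := Set.ncard_eq_one.1 h.degree_eq
  have h1 : f ∈ ({g} : Set Γ.E) := hg ▸ hf
  have h2 : Γ.rev e ∈ ({g} : Set Γ.E) := hg ▸ (rfl : Γ.ini (Γ.rev e) = Γ.ter e)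
  rw [Set.mem_singleton_iff.1 h1, Set.mem_singleton_iff.1 h2]

/-- Cutting the hair `e`: the edge `e`, its reverse and its terminal vertex are removed. -/
def cutHair (e : Γ.E) (h : Γ.IsHair e) : PGraph X where
  V := {a : Γ.V // a ≠ Γ.ter e}
  E := {f : Γ.E // f ≠ e ∧ f ≠ Γ.rev e}
  ini f := ⟨Γ.ini f.1, fun hf => f.2.2 (h.eq_rev hf)⟩
  rev f := ⟨Γ.rev f.1, fun hf => f.2.2 ((Γ.rev_rev f.1).symm.trans (congrArg Γ.rev hf)), fun hf => f.2.1 (by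
    rw [← Γ.rev_rev f.1, hf, Γ.rev_rev])⟩
  lab f := Γ.lab f.1
  rev_rev f := Subtype.ext (Γ.rev_rev f.1)
  lab_rev f := Γ.lab_rev f.1
  base := ⟨Γ.base, fun hb => h.ter_ne hb.symm⟩

/-- The graph obtained by identifying the vertices `a` and `b`. -/
def identify (a b : Γ.V) : PGraph X :=
  { Γ.identVerts (fun c d => c = a ∧ d = b) with base := Quot.mk _ Γ.base }

/-- The image of a vertex under an identification of two vertices. -/
def identifyV (a b : Γ.V) (c : Γ.V) : (Γ.identify a b).V := Quot.mk _ c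

/-- Removing the monochromatic component of `e`: all its edges and all its vertices that are
monochromatic in `Γ` are removed, its bichromatic vertices are kept. -/
def removeComp (e : Γ.E) (h : Γ.base ∉ Γ.compVM e) : PGraph X where
  V := {a : Γ.V // a ∉ Γ.compVM e}
  E := {f : Γ.E // f ∉ Γ.compE e}
  ini f := ⟨Γ.ini f.1, fun hf => f.2 ⟨hf.2 f.1 rfl, hf.1⟩⟩
  rev f := ⟨Γ.rev f.1, fun hf => f.2 (by
    have := LGraph.rev_mem_compE hf
    rwa [Γ.rev_rev] at this)⟩
  lab f := Γ.lab f.1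
  rev_rev f := Subtype.ext (Γ.rev_rev f.1)
  lab_rev f := Γ.lab_rev f.1
  base := ⟨Γ.base, h⟩

/-- The pointed graph with one vertex and no edges. -/
def trivial (X : Fin 2 → Type u) : PGraph X where
  V := PUnit
  E := PEmpty
  ini e := e.elim
  rev e := e
  lab e := e.elim
  rev_rev e := e.elim
  lab_rev e := e.elim
  base := PUnit.unit

/-- The `k`-th vertex on the loop labelled by the `j`-th word; the first and the last
one are the basepoint `none`. -/
def bouquetNode (ws : List (List (Letter X))) (j : Fin ws.length) (k : ℕ) :
    Option {p : Fin ws.length × ℕ // 0 < p.2 ∧ p.2 < (ws.get p.1).length} :=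
  if h : 0 < k ∧ k < (ws.get j).length then some ⟨(j, k), h⟩ else none

/-- The bouquet of loops at a common basepoint labelled by the given words. The edge
`((j, k), true)` is the `k`-th edge of the `j`-th loop and `((j, k), false)` is its reverse. -/
def bouquet (ws : List (List (Letter X))) : PGraph X where
  V := ULift.{u} (Option {p : Fin ws.length × ℕ // 0 < p.2 ∧ p.2 < (ws.get p.1).length})
  E := ULift.{u} ((Σ j : Fin ws.length, Fin (ws.get j).length) × Bool)
  ini e := ⟨bouquetNode ws e.down.1.1
    (if e.down.2 then (e.down.1.2 : ℕ) else (e.down.1.2 : ℕ) + 1)⟩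
  rev e := ⟨(e.down.1, !e.down.2)⟩
  lab e := if e.down.2 then (ws.get e.down.1.1).get e.down.1.2
    else ((ws.get e.down.1.1).get e.down.1.2).inv
  rev_rev e := by
    rcases e with ⟨⟨p, b⟩⟩
    simp
  lab_rev e := by
    rcases e with ⟨⟨p, b⟩⟩
    cases b <;> simp [Letter.inv]
  base := ⟨none⟩

end PGraph

end Graphs

/-! ## Cayley graphs of the factors

The `i`-th factor is the group `PresentedGroup (R i) = gp⟨X i | R i⟩`. -/

section Cayley

variable {X : Fin 2 → Type u} (R : ∀ i, Set (FreeGroup (X i)))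

/-- The element of the `i`-th factor represented by a signed generator. -/
def genVal {i : Fin 2} (x : X i × Bool) : PresentedGroup (R i) :=
  if x.2 then PresentedGroup.of x.1 else (PresentedGroup.of x.1)⁻¹

theorem genVal_not {i : Fin 2} (x : X i × Bool) :
    genVal R (x.1, !x.2) = (genVal R x)⁻¹ := by
  rcases x with ⟨x, b⟩
  cases b <;> simp [genVal]

/-- The Cayley graph of the `i`-th factor: the edge `(g, x)` goes from `g` to `g x`. -/
def cayley (i : Fin 2) : LGraph X where
  V := PresentedGroup (R i)
  E := PresentedGroup (R i) × (X i × Bool)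
  ini e := e.1
  rev e := (e.1 * genVal R e.2, (e.2.1, !e.2.2))
  lab e := (⟨i, e.2.1⟩, e.2.2)
  rev_rev e := by simp [genVal_not]
  lab_rev e := rfl

variable {R}

/-- Right multiplication by `g` on the right cosets of `S`. -/
def cosetMul {i : Fin 2} (S : Subgroup (PresentedGroup (R i)))
    (c : Quotient (QuotientGroup.rightRel S)) (g : PresentedGroup (R i)) :
    Quotient (QuotientGroup.rightRel S) :=
  Quotient.map (fun h => h * g) (fun a b hab => by
    change QuotientGroup.rightRel S _ _ at hab
    change QuotientGroup.rightRel S _ _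
    rw [QuotientGroup.rightRel_apply] at hab ⊢
    simpa [mul_assoc] using hab) c

/-- The relative Cayley graph of the `i`-th factor with respect to the subgroup `S`: its vertices
are the right cosets `S g`, and the edge `(S g, x)` goes from `S g` to `S g x`. -/
def relCayley {i : Fin 2} (S : Subgroup (PresentedGroup (R i))) : LGraph X where
  V := Quotient (QuotientGroup.rightRel S)
  E := Quotient (QuotientGroup.rightRel S) × (X i × Bool)
  ini e := e.1
  rev e := (cosetMul S e.1 (genVal R e.2), (e.2.1, !e.2.2))
  lab e := (⟨i, e.2.1⟩, e.2.2)
  rev_rev e := by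
    rcases e with ⟨c, x⟩
    induction c using Quotient.inductionOn with
    | h g => simp [cosetMul, genVal_not]
  lab_rev e := rfl

/-- The vertex `S g` of the relative Cayley graph. -/
def coset {i : Fin 2} (S : Subgroup (PresentedGroup (R i))) (g : PresentedGroup (R i)) :
    (relCayley S).V :=
  Quotient.mk (QuotientGroup.rightRel S) g

/-- For a vertex `t` of the monochromatic component `C` of `e`: the pointed graph `(C, t)` is
isomorphic to `(Cayley(G_i, S), S · 1)`, where `i` is the colour of `e`. -/
def CompIso (Γ : LGraph X) (e : Γ.E) (t : Γ.V) (S : Subgroup (PresentedGroup (R (Γ.color e)))) :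
    Prop :=
  ∃ f : (Γ.comp e).Iso (relCayley S), ∃ ht : t ∈ Γ.compV e, f.onV ⟨t, ht⟩ = coset S 1

end Cayley

/-! ## Words in the amalgam, precovers, reduced precovers

The amalgam `G = G_1 *_A G_2` is `Monoid.PushoutI φ`. -/

section Precovers

variable {X : Fin 2 → Type u} {R : ∀ i, Set (FreeGroup (X i))} {A : Type v} [Group A]
  (φ : ∀ i, A →* PresentedGroup (R i))

/-- The element of the amalgam that a word represents. -/
def val (w : List (Letter X)) : Monoid.PushoutI φ :=
  FreeGroup.lift (fun s : Σ i, X i => Monoid.PushoutI.of (φ := φ) s.1 (PresentedGroup.of s.2))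
    (FreeGroup.mk w)

/-- The amalgamated subgroup `A` of `G`, as a set. -/
def amal : Set (Monoid.PushoutI φ) := Set.range (Monoid.PushoutI.base φ)

/-- `Lab(Γ, v₀)`: the elements of `G` represented by the labels of paths closed at `v₀`. -/
def Lab (Γ : PGraph X) : Set (Monoid.PushoutI φ) :=
  {g | ∃ w, Γ.HasPath Γ.base w Γ.base ∧ val φ w = g}

/-- `Lab(C, a)`, as a subset of `G`, where `C` is the monochromatic component of colour `i`
that contains `a`. -/
def monoLab (Γ : LGraph X) (i : Fin 2) (a : Γ.V) : Set (Monoid.PushoutI φ) :=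
  {g | ∃ w, Γ.HasMonoPath i a w a ∧ val φ w = g}

/-- The orbit `{a · g | g ∈ A}` of the vertex `a` in the monochromatic component of
colour `i` that contains `a`. -/
def orbit (Γ : LGraph X) (i : Fin 2) (a : Γ.V) : Set Γ.V :=
  {b | ∃ w, Γ.HasMonoPath i a w b ∧ val φ w ∈ amal φ}

/-- Every path whose label is trivial in `G` is closed. -/
def GBased (Γ : LGraph X) : Prop := ∀ a b w, Γ.HasPath a w b → val φ w = 1 → a = b

/-- A (connected) precover of `G`: a `G`-based graph each of whose monochromatic components of
colour `i` is isomorphic to a relative Cayley graph of the factor `G_i`. -/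
structure IsPrecover (Γ : LGraph X) : Prop where
  connected : Γ.Connected
  gBased : GBased φ Γ
  cover : ∀ e : Γ.E, ∃ S : Subgroup (PresentedGroup (R (Γ.color e))),
    Nonempty ((Γ.comp e).Iso (relCayley S))

/-- The monochromatic component of the edge `e` is redundant. -/
def Redundant (Γ : PGraph X) (e : Γ.E) : Prop :=
  ((∀ f, f ∈ Γ.compE e) ∧ monoLab φ Γ.toLGraph (Γ.color e) Γ.base = {1}) ∨
  ((∃ f, f ∉ Γ.compE e) ∧ ∃ t ∈ Γ.compVB e,
    monoLab φ Γ.toLGraph (Γ.color e) t ⊆ amal φ ∧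
    Γ.compVB e = orbit φ Γ.toLGraph (Γ.color e) t ∧
    (Γ.base ∉ Γ.compV e ∨
      (Γ.base ∈ Γ.compVB e ∧ monoLab φ Γ.toLGraph (Γ.color e) t = {1})))

/-- A reduced precover of `G`. -/
structure IsReducedPrecover (Γ : PGraph X) : Prop where
  precover : IsPrecover φ Γ.toLGraph
  not_redundant : ∀ e, ¬ Redundant φ Γ e
  base_cond : ∀ e : Γ.E, Γ.base ∈ Γ.compV e →
    monoLab φ Γ.toLGraph (Γ.color e) Γ.base ∩ amal φ ≠ {1} →
    ∃ f : Γ.E, Γ.color f ≠ Γ.color e ∧ Γ.base ∈ Γ.compV f ∧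
      monoLab φ Γ.toLGraph (Γ.color e) Γ.base ∩ amal φ =
        monoLab φ Γ.toLGraph (Γ.color f) Γ.base ∩ amal φ

end Precovers

/-! ## The generalized Stallings algorithm

The algorithm makes choices (which edges to fold, in which order to run through a set, ...),
so it is modelled by its transition relation on configurations; each maximal chain of
transitions is one execution. -/

section Algorithm

variable {X : Fin 2 → Type u} {R : ∀ i, Set (FreeGroup (X i))} {A : Type v} [Group A]
  (φ : ∀ i, A →* PresentedGroup (R i))

/-- The list contains exactly one edge of each monochromatic component, in some order. -/
def PicksEdges (Γ : LGraph X) (L : List Γ.E) : Prop :=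
  ∀ e : Γ.E, ∃! k : Fin L.length, L.get k ∈ Γ.compE e

/-- Step 3: glue a copy of the Cayley graph of the factor of the colour of `e` to `Γ` by
identifying `e` with the edge of the Cayley graph that starts at `1` and has the same label. -/
def glueCayley (R : ∀ i, Set (FreeGroup (X i))) (Γ : PGraph X) (e : Γ.E) : PGraph X :=
  { (Γ.toLGraph.disjUnion (cayley R (Γ.color e))).identEdges (Sum.inl e)
      (Sum.inr (1, ((Γ.lab e).1.2, (Γ.lab e).2))) rfl with
    base := Quot.mk _ (Sum.inl Γ.base) }

/-- The image of an edge of `Γ` after the gluing of step 3. -/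
def glueCayleyE (R : ∀ i, Set (FreeGroup (X i))) (Γ : PGraph X) (e a : Γ.E) :
    (glueCayley R Γ e).E := Quot.mk _ (Sum.inl a)

/-- Step 4: some paths `p₀` of colour `0` and `p₁` of colour `1`, which start at `c`, whose labels
are equal in `G` and lie in `A`, end at the distinct vertices `a` and `b`, respectively. -/
def Conflict (Γ : LGraph X) (c a b : Γ.V) : Prop :=
  a ≠ b ∧ ∃ w₀ w₁, Γ.HasMonoPath 0 c w₀ a ∧ Γ.HasMonoPath 1 c w₁ b ∧
    val φ w₀ ∈ amal φ ∧ val φ w₁ ∈ amal φ ∧ val φ w₀ = val φ w₁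

/-- Step 5: the component of `e` is to be removed. Here `K ≤ A` is a subgroup of the factor. -/
def Removable (Γ : PGraph X) (e : Γ.E) : Prop :=
  ∃ t ∈ Γ.compVB e, ∃ K : Subgroup (PresentedGroup (R (Γ.color e))),
    K ≤ (φ (Γ.color e)).range ∧ CompIso Γ.toLGraph e t K ∧
    (Γ.compVB e).ncard = K.relIndex (φ (Γ.color e)).range ∧
    ((K = ⊥ ∧ Γ.base ∉ Γ.compVM e) ∨ (K ≠ ⊥ ∧ Γ.base ∉ Γ.compV e))

theorem Removable.base_notMem {Γ : PGraph X} {e : Γ.E} (h : Removable φ Γ e) :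
    Γ.base ∉ Γ.compVM e := by
  obtain ⟨_, _, _, _, _, _, ⟨_, h⟩ | ⟨_, h⟩⟩ := h
  · exact h
  · exact fun hb => h hb.1

/-- End of step 5: no vertex is bichromatic and `(Γ, v₀)` is isomorphic to `(Cayley(G_i), 1)`. -/
def IsCayley (R : ∀ i, Set (FreeGroup (X i))) (Γ : PGraph X) : Prop :=
  Γ.VB = ∅ ∧ ∃ i, ∃ f : Γ.toLGraph.Iso (cayley R i), f.onV Γ.base = (1 : PresentedGroup (R i))

/-- Step 6, the test: the basepoint is monochromatic of the colour `i` of `e`, it lies in the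
component `C` of `e`, `(C, v₀)` is isomorphic to `(Cayley(G_i, K), K · 1)`, and `K ∩ A` is not
trivial. The intersection `K ∩ A` is taken in `A`. -/
def NeedsGlue (Γ : PGraph X) (e : Γ.E) (K : Subgroup (PresentedGroup (R (Γ.color e)))) : Prop :=
  Γ.Monochromatic (Γ.color e) Γ.base ∧ CompIso Γ.toLGraph e Γ.base K ∧
    K.comap (φ (Γ.color e)) ≠ ⊥

/-- Step 6, the relation on vertices: `v₀ · a` is identified with `L · a` for all `a ∈ A`.
Here `v₀ · a` is read in the component of colour `i`, and `L` is a subgroup of the factor `j`. -/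
def GlueRel (Γ : PGraph X) (i : Fin 2) {j : Fin 2} (L : Subgroup (PresentedGroup (R j)))
    (c d : (Γ.toLGraph.disjUnion (relCayley L)).V) : Prop :=
  ∃ (a : A) (b : Γ.V) (w : List (Letter X)), Γ.HasMonoPath i Γ.base w b ∧
    val φ w = Monoid.PushoutI.base φ a ∧ c = Sum.inl b ∧ d = Sum.inr (coset L (φ j a))

/-- Step 6, the gluing of `Cayley(G_j, L)`, along the `A`-orbit of the basepoint read in
colour `i`. -/
def glueRelCayley (Γ : PGraph X) (i : Fin 2) {j : Fin 2}
    (L : Subgroup (PresentedGroup (R j))) : PGraph X :=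
  { (Γ.toLGraph.disjUnion (relCayley L)).identVerts (GlueRel φ Γ i L) with
    base := Quot.mk _ (Sum.inl Γ.base) }

/-- The configurations of the algorithm: the step that is being executed and the current graph.
In step 3 the list consists of the (images of the) chosen edges of the components of `Γ₂` that
have not been processed yet; in step 4 the set is the image of the set of
bichromatic vertices of `Γ₃`. -/
inductive Config (X : Fin 2 → Type u) : Type (u + 1)
  | step2 (Γ : PGraph X)
  | step3 (Γ : PGraph X) (L : List Γ.E)
  | step4 (Γ : PGraph X) (B : Set Γ.V)
  | step5 (Γ : PGraph X)
  | step6 (Γ : PGraph X)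
  | output (Γ : PGraph X)

/-- The configuration after step 1. -/
def Config.start (ws : List (List (Letter X))) : Config X := .step2 (PGraph.bouquet ws)

/-- The transitions of the algorithm. -/
inductive Transition : Config X → Config X → Prop
  /- Step 2: fold edges and cut hairs as long as possible. -/
  | fold2 (Γ : PGraph X) (e f : Γ.E) (h : Γ.Foldable e f) :
      Transition (.step2 Γ) (.step2 (Γ.fold e f h))
  | cut2 (Γ : PGraph X) (e : Γ.E) (h : Γ.IsHair e) :
      Transition (.step2 Γ) (.step2 (Γ.cutHair e h))
  | end2 (Γ : PGraph X) (hw : Γ.WellLabelled) (hh : ∀ e, ¬ Γ.IsHair e)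
      (L : List Γ.E) (hL : PicksEdges Γ.toLGraph L) :
      Transition (.step2 Γ) (.step3 Γ L)
  /- Step 3: for each monochromatic component of `Γ₂`, glue a copy of the Cayley graph of the
  factor along the chosen edge, then fold as long as possible. -/
  | fold3 (Γ : PGraph X) (L : List Γ.E) (e f : Γ.E) (h : Γ.Foldable e f) :
      Transition (.step3 Γ L) (.step3 (Γ.fold e f h) (L.map (Γ.foldE e f h)))
  | glue3 (Γ : PGraph X) (e : Γ.E) (L : List Γ.E) (hw : Γ.WellLabelled) :
      Transition (.step3 Γ (e :: L)) (.step3 (glueCayley R Γ e) (L.map (glueCayleyE R Γ e)))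
  | end3 (Γ : PGraph X) (hw : Γ.WellLabelled) :
      Transition (.step3 Γ []) (.step4 Γ Γ.VB)
  /- Step 4: at the bichromatic vertices of `Γ₃`, identify the endpoints of pairs of paths of
  different colours with the same label in `A`, and fold, as long as possible; the order is
  arbitrary. -/
  | fold4 (Γ : PGraph X) (B : Set Γ.V) (e f : Γ.E) (h : Γ.Foldable e f) :
      Transition (.step4 Γ B) (.step4 (Γ.fold e f h) (Γ.foldV e f h '' B))
  | identify4 (Γ : PGraph X) (B : Set Γ.V) (c a b : Γ.V) (hc : c ∈ B)
      (h : Conflict φ Γ.toLGraph c a b) :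
      Transition (.step4 Γ B) (.step4 (Γ.identify a b) (Γ.identifyV a b '' B))
  | end4 (Γ : PGraph X) (B : Set Γ.V) (hw : Γ.WellLabelled)
      (h : ∀ c ∈ B, ∀ a b, ¬ Conflict φ Γ.toLGraph c a b) :
      Transition (.step4 Γ B) (.step5 Γ)
  /- Step 5: remove redundant components as long as possible; if what remains is the Cayley graph
  of a factor, replace it by the graph with one vertex and no edges. -/
  | remove5 (Γ : PGraph X) (e : Γ.E) (h : Removable φ Γ e) :
      Transition (.step5 Γ) (.step5 (Γ.removeComp e (h.base_notMem φ)))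
  | collapse5 (Γ : PGraph X) (h : ∀ e, ¬ Removable φ Γ e) (hc : IsCayley R Γ) :
      Transition (.step5 Γ) (.step6 (PGraph.trivial X))
  | end5 (Γ : PGraph X) (h : ∀ e, ¬ Removable φ Γ e) (hc : ¬ IsCayley R Γ) :
      Transition (.step5 Γ) (.step6 Γ)
  /- Step 6: if necessary, glue `Cayley(G_j, L)` at the basepoint, where `L = K ∩ A`. -/
  | glue6 (Γ : PGraph X) (e : Γ.E) (K : Subgroup (PresentedGroup (R (Γ.color e))))
      (h : NeedsGlue φ Γ e K) (j : Fin 2) (hj : j ≠ Γ.color e) :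
      Transition (.step6 Γ)
        (.output (glueRelCayley φ Γ (Γ.color e) ((K.comap (φ (Γ.color e))).map (φ j))))
  | end6 (Γ : PGraph X)
      (h : ∀ e (K : Subgroup (PresentedGroup (R (Γ.color e)))), ¬ NeedsGlue φ Γ e K) :
      Transition (.step6 Γ) (.output Γ)

/-- The configuration is reached in some execution on the input `ws`. -/
def Reachable (ws : List (List (Letter X))) (c : Config X) : Prop :=
  Relation.ReflTransGen (Transition φ) (Config.start ws) c

end Algorithm

end Stallings

/-!
Two invariants make the graph of a configuration determine `H`: it is connected with `H` contained
in its language, and its vertices carry a potential with values in `G ⧸ H`, which sends the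
basepoint to `H` and is compatible with the labels. The potential forces the language to be
contained in `H`. Folding, the identifications of step 4 and the gluings respect the potential
because they identify the ends of paths whose labels are equal in `G`. A removed hair or component
is replaced by detours: `VB(C)` is an `A`-orbit, so a path through the component `C` can be
replaced by a path with the same value in the other factor.

If every monochromatic component is covered by the Cayley graph of its factor, then the elements of
`A` act on the bichromatic vertices through either factor, and step 4 makes the two actions agree.
The normal form theorem for amalgams then shows that every path whose label is trivial in `G` is
closed. Termination is a lexicographic descent: the number of remaining steps, the number of
remaining gluings of step 3, the number of vertices and edges.
-/

namespace Stallings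

open Monoid (PushoutI)

section Morphisms

variable {X : Fin 2 → Type u}

/-- The letter of colour `i` given by a signed generator. -/
def letter (i : Fin 2) (x : X i × Bool) : Letter X := (⟨i, x.1⟩, x.2)

theorem letter_injective (i : Fin 2) : Function.Injective (letter (X := X) i) := by
  rintro ⟨x, b⟩ ⟨y, c⟩ h
  simp only [letter, Prod.mk.injEq, Sigma.mk.injEq, heq_eq_eq, true_and] at h
  rw [h.1, h.2]

theorem Letter.exists_eq_letter {i : Fin 2} {l : Letter X} (h : l.color = i) :
    ∃ x : X i × Bool, l = letter i x := by
  obtain ⟨⟨k, x⟩, b⟩ := l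
  obtain rfl : k = i := h
  exact ⟨(x, b), rfl⟩

theorem exists_eq_map_letter {i : Fin 2} {w : List (Letter X)} (hw : ∀ l ∈ w, l.color = i) :
    ∃ u : List (X i × Bool), w = u.map (letter i) := by
  induction w with
  | nil => exact ⟨[], rfl⟩
  | cons l w ih =>
    obtain ⟨x, rfl⟩ := Letter.exists_eq_letter (hw l List.mem_cons_self)
    obtain ⟨u, rfl⟩ := ih fun l hl => hw l (List.mem_cons_of_mem _ hl)
    exact ⟨x :: u, rfl⟩

theorem color_of_mem_map_letter {i : Fin 2} {u : List (X i × Bool)} {l : Letter X}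
    (hl : l ∈ u.map (letter i)) : l.color = i := by
  obtain ⟨x, -, rfl⟩ := List.mem_map.1 hl
  rfl

namespace LGraph

variable {Γ Δ Θ : LGraph X} {i : Fin 2} {a b c : Γ.V} {w w' : List (Letter X)} {e f g : Γ.E}

/-! ### Paths and components -/

theorem ter_rev (e : Γ.E) : Γ.ter (Γ.rev e) = Γ.ini e := by
  rw [ter, Γ.rev_rev]

theorem HasPath.edge (e : Γ.E) : Γ.HasPath (Γ.ini e) [Γ.lab e] (Γ.ter e) :=
  .cons e (.nil _)

theorem hasPath_cons_iff {l : Letter X} :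
    Γ.HasPath a (l :: w) b ↔ ∃ e, Γ.ini e = a ∧ Γ.lab e = l ∧ Γ.HasPath (Γ.ter e) w b := by
  constructor
  · intro h
    cases h with
    | cons e h => exact ⟨e, rfl, rfl, h⟩
  · rintro ⟨e, rfl, rfl, h⟩
    exact .cons e h

theorem WellLabelled.hasPath_unique (hΓ : Γ.WellLabelled) (h : Γ.HasPath a w b)
    (h' : Γ.HasPath a w c) : b = c := by
  induction h with
  | nil a => cases h'; rfl
  | cons e _ ih =>
    obtain ⟨f, hi, hl, hf⟩ := hasPath_cons_iff.1 h'
    exact ih (hΓ f e hi hl ▸ hf)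

theorem HasPath.append (h : Γ.HasPath a w b) (h' : Γ.HasPath b w' c) :
    Γ.HasPath a (w ++ w') c := by
  induction h with
  | nil a => exact h'
  | cons e _ ih => exact .cons e (ih h')

theorem HasPath.reverse (h : Γ.HasPath a w b) :
    Γ.HasPath b (w.reverse.map Letter.inv) a := by
  induction h with
  | nil a => exact .nil _
  | cons e _ ih =>
    have := ih.append (HasPath.edge (Γ.rev e))
    rw [Γ.ter_rev, Γ.lab_rev] at this
    simpa using this

theorem HasMonoPath.nil (i : Fin 2) (a : Γ.V) : Γ.HasMonoPath i a [] a :=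
  ⟨.nil a, by simp⟩

theorem HasMonoPath.append (h : Γ.HasMonoPath i a w b) (h' : Γ.HasMonoPath i b w' c) :
    Γ.HasMonoPath i a (w ++ w') c :=
  ⟨h.1.append h'.1, fun l hl => (List.mem_append.1 hl).elim (h.2 l) (h'.2 l)⟩

theorem HasMonoPath.reverse (h : Γ.HasMonoPath i a w b) :
    Γ.HasMonoPath i b (w.reverse.map Letter.inv) a := by
  refine ⟨h.1.reverse, fun l hl => ?_⟩
  obtain ⟨m, hm, rfl⟩ := List.mem_map.1 hl
  exact h.2 m (List.mem_reverse.1 hm)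

theorem HasPath.hasMonoPath (h : Γ.HasPath a w b) (hi : ∀ e, Γ.color e = i) :
    Γ.HasMonoPath i a w b := by
  refine ⟨h, ?_⟩
  induction h with
  | nil => simp
  | cons e _ ih => exact List.forall_mem_cons.2 ⟨hi e, ih⟩

theorem connected_of_forall_hasPath (v : Γ.V) (h : ∀ a, ∃ w, Γ.HasPath v w a) : Γ.Connected :=
  ⟨⟨v⟩, fun a b => ⟨_, (h a).choose_spec.reverse.append (h b).choose_spec⟩⟩

/-- An edge of colour `i` starts at `a`. -/
def Inc (Γ : LGraph X) (i : Fin 2) (a : Γ.V) : Prop := ∃ e, Γ.ini e = a ∧ Γ.color e = i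

theorem inc_ini (e : Γ.E) : Γ.Inc (Γ.color e) (Γ.ini e) := ⟨e, rfl, rfl⟩

theorem inc_ter (e : Γ.E) : Γ.Inc (Γ.color e) (Γ.ter e) := ⟨Γ.rev e, rfl, Γ.color_rev e⟩

theorem mem_VB_of_ne {i j : Fin 2} (hij : i ≠ j) (hi : Γ.Inc i a) (hj : Γ.Inc j a) :
    a ∈ Γ.VB := by
  intro k
  obtain rfl | rfl : k = i ∨ k = j := by omega
  · exact hi
  · exact hj

theorem HasMonoPath.inc (h : Γ.HasMonoPath i a w b) (ha : Γ.Inc i a) : Γ.Inc i b := by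
  obtain ⟨h, hl⟩ := h
  induction h with
  | nil a => exact ha
  | cons e _ ih =>
    obtain rfl : Γ.color e = i := hl _ List.mem_cons_self
    exact ih (inc_ter e) fun l hm => hl l (List.mem_cons_of_mem _ hm)

theorem ini_mem_compV (e : Γ.E) : Γ.ini e ∈ Γ.compV e := ⟨[], .nil _ _⟩

theorem self_mem_compE (e : Γ.E) : e ∈ Γ.compE e := ⟨rfl, ini_mem_compV e⟩

theorem inc_of_mem_compV (h : a ∈ Γ.compV e) : Γ.Inc (Γ.color e) a :=
  h.choose_spec.inc (inc_ini e)

theorem ter_mem_compV (h : f ∈ Γ.compE e) : Γ.ter f ∈ Γ.compV e :=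
  (rev_mem_compE h).2

theorem compV_subset_of_mem_compE (h : f ∈ Γ.compE e) : Γ.compV f ⊆ Γ.compV e := by
  rintro a ⟨w, hw⟩
  obtain ⟨w', hw'⟩ := h.2
  exact ⟨w' ++ w, hw'.append (h.1 ▸ hw)⟩

theorem compE_subset_of_mem_compE (h : f ∈ Γ.compE e) : Γ.compE f ⊆ Γ.compE e :=
  fun _ hg => ⟨hg.1.trans h.1, compV_subset_of_mem_compE h hg.2⟩

theorem mem_compE_symm (h : f ∈ Γ.compE e) : e ∈ Γ.compE f := by
  obtain ⟨w, hw⟩ := h.2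
  exact ⟨h.1.symm, _, h.1.symm ▸ hw.reverse⟩

/-! ### Morphisms -/

/-- A morphism of labelled graphs. -/
structure Hom (Γ Δ : LGraph X) where
  onV : Γ.V → Δ.V
  onE : Γ.E → Δ.E
  ini_onE : ∀ e, Δ.ini (onE e) = onV (Γ.ini e)
  rev_onE : ∀ e, Δ.rev (onE e) = onE (Γ.rev e)
  lab_onE : ∀ e, Δ.lab (onE e) = Γ.lab e

namespace Hom

theorem ter_onE (f : Γ.Hom Δ) (e : Γ.E) : Δ.ter (f.onE e) = f.onV (Γ.ter e) := by
  rw [ter, f.rev_onE, f.ini_onE, ter]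

theorem color_onE (f : Γ.Hom Δ) (e : Γ.E) : Δ.color (f.onE e) = Γ.color e := by
  rw [color, f.lab_onE, color]

/-- The composition of two morphisms. -/
def comp (g : Δ.Hom Θ) (f : Γ.Hom Δ) : Γ.Hom Θ where
  onV := g.onV ∘ f.onV
  onE := g.onE ∘ f.onE
  ini_onE e := by simp [g.ini_onE, f.ini_onE]
  rev_onE e := by simp [g.rev_onE, f.rev_onE]
  lab_onE e := by simp [g.lab_onE, f.lab_onE]

theorem onE_injective (f : Γ.Hom Δ) (hΓ : Γ.WellLabelled) (hf : Function.Injective f.onV) :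
    Function.Injective f.onE := by
  intro e e' h
  refine hΓ e e' (hf ?_) ?_
  · rw [← f.ini_onE, h, f.ini_onE]
  · rw [← f.lab_onE, h, f.lab_onE]

end Hom

/-- The isomorphism given by a bijective morphism. -/
noncomputable def Iso.ofBijective (f : Γ.Hom Δ) (hV : Function.Bijective f.onV)
    (hE : Function.Bijective f.onE) : Γ.Iso Δ where
  onV := .ofBijective f.onV hV
  onE := .ofBijective f.onE hE
  ini_onE := f.ini_onE
  rev_onE := f.rev_onE
  lab_onE := f.lab_onE

/-- An isomorphism, regarded as a morphism. -/
def Iso.toHom (f : Γ.Iso Δ) : Γ.Hom Δ where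
  onV := f.onV
  onE := f.onE
  ini_onE := f.ini_onE
  rev_onE := f.rev_onE
  lab_onE := f.lab_onE

/-- The inverse isomorphism. -/
def Iso.symm (f : Γ.Iso Δ) : Δ.Iso Γ where
  onV := f.onV.symm
  onE := f.onE.symm
  ini_onE e := by
    obtain ⟨e, rfl⟩ := f.onE.surjective e
    rw [f.ini_onE, Equiv.symm_apply_apply, Equiv.symm_apply_apply]
  rev_onE e := by
    obtain ⟨e, rfl⟩ := f.onE.surjective e
    rw [f.rev_onE, Equiv.symm_apply_apply, Equiv.symm_apply_apply]
  lab_onE e := by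
    obtain ⟨e, rfl⟩ := f.onE.surjective e
    rw [Equiv.symm_apply_apply, f.lab_onE]

theorem HasPath.map (f : Γ.Hom Δ) (h : Γ.HasPath a w b) :
    Δ.HasPath (f.onV a) w (f.onV b) := by
  induction h with
  | nil a => exact .nil _
  | cons e _ ih =>
    rw [← f.ini_onE, ← f.lab_onE]
    exact .cons _ (by rwa [f.ter_onE])

theorem Inc.map (f : Γ.Hom Δ) (h : Γ.Inc i a) : Δ.Inc i (f.onV a) := by
  obtain ⟨e, rfl, rfl⟩ := h
  exact ⟨f.onE e, f.ini_onE e, f.color_onE e⟩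

theorem mem_compV_map (f : Γ.Hom Δ) (h : a ∈ Γ.compV e) : f.onV a ∈ Δ.compV (f.onE e) := by
  obtain ⟨w, hp, hl⟩ := h
  exact ⟨w, by rw [f.ini_onE]; exact hp.map f, by rwa [f.color_onE]⟩

theorem Connected.of_surjective (hΓ : Γ.Connected) (f : Γ.Hom Δ)
    (hf : Function.Surjective f.onV) : Δ.Connected := by
  refine ⟨hΓ.1.map f.onV, fun a b => ?_⟩
  obtain ⟨a, rfl⟩ := hf a
  obtain ⟨b, rfl⟩ := hf b
  exact (hΓ.2 a b).imp fun _ h => h.map f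

/-- The inclusion of a monochromatic component. -/
def compHom (Γ : LGraph X) (e : Γ.E) : (Γ.comp e).Hom Γ where
  onV := Subtype.val
  onE := Subtype.val
  ini_onE _ := rfl
  rev_onE _ := rfl
  lab_onE _ := rfl

/-- The corestriction of a morphism to a monochromatic component that contains its image. -/
def Hom.toComp (f : Γ.Hom Δ) (e : Δ.E) (hV : ∀ a, f.onV a ∈ Δ.compV e)
    (hE : ∀ e', Γ.color e' = Δ.color e) : Γ.Hom (Δ.comp e) where
  onV a := ⟨f.onV a, hV a⟩
  onE e' := ⟨f.onE e', (f.color_onE e').trans (hE e'), (f.ini_onE e').symm ▸ hV _⟩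
  ini_onE e' := Subtype.ext (f.ini_onE e')
  rev_onE e' := Subtype.ext (f.rev_onE e')
  lab_onE e' := f.lab_onE e'

/-- The canonical morphism onto the graph with two edges identified. -/
def identEdgesHom (Γ : LGraph X) (e f : Γ.E) (h : Γ.lab e = Γ.lab f) :
    Γ.Hom (Γ.identEdges e f h) where
  onV := Quot.mk _
  onE := Quot.mk _
  ini_onE _ := rfl
  rev_onE _ := rfl
  lab_onE _ := rfl

/-- The canonical morphism onto the graph with some vertices identified. -/
def identVertsHom (Γ : LGraph X) (r : Γ.V → Γ.V → Prop) : Γ.Hom (Γ.identVerts r) where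
  onV := Quot.mk _
  onE := id
  ini_onE _ := rfl
  rev_onE _ := rfl
  lab_onE _ := rfl

/-- The inclusion of the first summand of a disjoint union. -/
def inlHom (Γ Δ : LGraph X) : Γ.Hom (Γ.disjUnion Δ) where
  onV := Sum.inl
  onE := Sum.inl
  ini_onE _ := rfl
  rev_onE _ := rfl
  lab_onE _ := rfl

/-- The inclusion of the second summand of a disjoint union. -/
def inrHom (Γ Δ : LGraph X) : Δ.Hom (Γ.disjUnion Δ) where
  onV := Sum.inr
  onE := Sum.inr
  ini_onE _ := rfl
  rev_onE _ := rfl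
  lab_onE _ := rfl

end LGraph

end Morphisms

section Values

variable {X : Fin 2 → Type u} {R : ∀ i, Set (FreeGroup (X i))} {A : Type v} [Group A]
  (φ : ∀ i, A →* PresentedGroup (R i))

@[simp]
theorem val_nil : val φ [] = 1 := by simp [val, FreeGroup.lift_mk]

theorem val_append (w w' : List (Letter X)) : val φ (w ++ w') = val φ w * val φ w' := by
  simp [val, FreeGroup.lift_mk]

theorem val_cons (l : Letter X) (w : List (Letter X)) : val φ (l :: w) = val φ [l] * val φ w :=
  val_append φ [l] w

theorem val_inv (l : Letter X) : val φ [l.inv] = (val φ [l])⁻¹ := by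
  obtain ⟨x, b⟩ := l
  cases b <;> simp [val, FreeGroup.lift_mk, Letter.inv]

theorem val_reverse (w : List (Letter X)) :
    val φ (w.reverse.map Letter.inv) = (val φ w)⁻¹ := by
  induction w with
  | nil => simp
  | cons l w ih =>
    rw [val_cons, mul_inv_rev, ← ih, ← val_inv, ← val_append]
    simp

theorem val_letter (i : Fin 2) (x : X i × Bool) :
    val φ [letter i x] = PushoutI.of (φ := φ) i (genVal R x) := by
  obtain ⟨x, b⟩ := x
  cases b <;> simp [val, FreeGroup.lift_mk, letter, genVal]

theorem val_map_letter (i : Fin 2) (u : List (X i × Bool)) :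
    val φ (u.map (letter i)) = PushoutI.of (φ := φ) i (u.map (genVal R)).prod := by
  induction u with
  | nil => simp
  | cons x u ih =>
    rw [List.map_cons, val_cons, val_letter, ih, List.map_cons, List.prod_cons, map_mul]

theorem exists_prod_genVal_eq {i : Fin 2} (g : PresentedGroup (R i)) :
    ∃ u : List (X i × Bool), (u.map (genVal R)).prod = g := by
  induction g using PresentedGroup.induction_on with
  | _ z =>
    induction z using FreeGroup.induction_on with
    | C1 => exact ⟨[], by simp⟩
    | of x => exact ⟨[(x, true)], by simp [genVal, PresentedGroup.of]⟩
    | inv_of x _ => exact ⟨[(x, false)], by simp [genVal, PresentedGroup.of]⟩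
    | mul y z hy hz =>
      obtain ⟨u, hu⟩ := hy
      obtain ⟨u', hu'⟩ := hz
      exact ⟨u ++ u', by rw [List.map_append, List.prod_append, hu, hu', map_mul]⟩

variable {φ}

theorem of_mem_amal_iff (hφ : ∀ i, Function.Injective (φ i)) {i : Fin 2}
    {g : PresentedGroup (R i)} : PushoutI.of (φ := φ) i g ∈ amal φ ↔ g ∈ (φ i).range := by
  constructor
  · rintro ⟨x, hx⟩
    rw [← PushoutI.of_apply_eq_base φ i] at hx
    exact ⟨x, PushoutI.of_injective hφ i hx⟩
  · rintro ⟨x, rfl⟩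
    exact ⟨x, (PushoutI.of_apply_eq_base φ i x).symm⟩

end Values

section FactorPaths

variable {X : Fin 2 → Type u} {R : ∀ i, Set (FreeGroup (X i))} {Γ Δ : LGraph X} {i : Fin 2}
  {a b c : Γ.V} {g h : PresentedGroup (R i)}

namespace LGraph

variable (R) in
/-- Some path from `a` to `b` is labelled by a word over the generators of the `i`-th factor that
represents the element `g` of this factor; the paper writes `b = a · g`. -/
def HasFactorPath (Γ : LGraph X) (i : Fin 2) (a : Γ.V) (g : PresentedGroup (R i)) (b : Γ.V) :
    Prop :=
  ∃ u : List (X i × Bool), Γ.HasPath a (u.map (letter i)) b ∧ (u.map (genVal R)).prod = g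

namespace HasFactorPath

variable (R) in
theorem refl (i : Fin 2) (a : Γ.V) : Γ.HasFactorPath R i a 1 a := ⟨[], .nil _, rfl⟩

theorem trans (H : Γ.HasFactorPath R i a g b) (H' : Γ.HasFactorPath R i b h c) :
    Γ.HasFactorPath R i a (g * h) c := by
  obtain ⟨u, hu, rfl⟩ := H
  obtain ⟨u', hu', rfl⟩ := H'
  exact ⟨u ++ u', by simpa using hu.append hu', by simp⟩

theorem symm (H : Γ.HasFactorPath R i a g b) : Γ.HasFactorPath R i b g⁻¹ a := by
  obtain ⟨u, hu, rfl⟩ := H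
  refine ⟨(u.map fun x => (x.1, !x.2)).reverse, ?_, ?_⟩
  · simpa [letter, Letter.inv, Function.comp_def] using hu.reverse
  · simp [List.prod_inv_reverse, genVal_not, Function.comp_def]

theorem edge (e : Γ.E) {x : X i × Bool} (hx : Γ.lab e = letter i x) :
    Γ.HasFactorPath R i (Γ.ini e) (genVal R x) (Γ.ter e) :=
  ⟨[x], by simpa [hx] using HasPath.edge e, by simp⟩

theorem map (f : Γ.Hom Δ) (H : Γ.HasFactorPath R i a g b) :
    Δ.HasFactorPath R i (f.onV a) g (f.onV b) := by
  obtain ⟨u, hu, hg⟩ := H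
  exact ⟨u, hu.map f, hg⟩

theorem exists_monoPath (H : Γ.HasFactorPath R i a g b) : ∃ w, Γ.HasMonoPath i a w b := by
  obtain ⟨u, hu, -⟩ := H
  exact ⟨_, hu, fun _ => color_of_mem_map_letter⟩

theorem inc (H : Γ.HasFactorPath R i a g b) (ha : Γ.Inc i a) : Γ.Inc i b :=
  H.exists_monoPath.choose_spec.inc ha

theorem inc_of_ne_one (H : Γ.HasFactorPath R i a g b) (hg : g ≠ 1) : Γ.Inc i a := by
  obtain ⟨_ | ⟨x, u⟩, hu, rfl⟩ := H
  · exact absurd rfl hg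
  · obtain ⟨e, he, hl, -⟩ := hasPath_cons_iff.1 hu
    exact ⟨e, he, congrArg Letter.color hl⟩

end HasFactorPath

variable (R) in
theorem HasMonoPath.exists_factorPath {w : List (Letter X)} (H : Γ.HasMonoPath i a w b) :
    ∃ g, Γ.HasFactorPath R i a g b := by
  obtain ⟨u, rfl⟩ := exists_eq_map_letter H.2
  exact ⟨_, u, H.1, rfl⟩

variable (R) in
theorem mem_compV_iff {e : Γ.E} :
    a ∈ Γ.compV e ↔ ∃ g, Γ.HasFactorPath R (Γ.color e) (Γ.ini e) g a :=
  ⟨fun ⟨_, h⟩ => h.exists_factorPath R, fun ⟨_, h⟩ => h.exists_monoPath⟩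

variable (R) in
theorem exists_factorPath_of_mem_compV {e : Γ.E} (ha : a ∈ Γ.compV e) (hb : b ∈ Γ.compV e) :
    ∃ g, Γ.HasFactorPath R (Γ.color e) a g b := by
  obtain ⟨g, hg⟩ := (mem_compV_iff R).1 ha
  obtain ⟨h, hh⟩ := (mem_compV_iff R).1 hb
  exact ⟨_, hg.symm.trans hh⟩

theorem HasFactorPath.mem_compV {e : Γ.E} {g : PresentedGroup (R (Γ.color e))}
    (H : Γ.HasFactorPath R (Γ.color e) a g b) (ha : a ∈ Γ.compV e) : b ∈ Γ.compV e := by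
  obtain ⟨h, hh⟩ := (mem_compV_iff R).1 ha
  exact (mem_compV_iff R).2 ⟨_, hh.trans H⟩

variable (R) in
/-- The stabilizer of the vertex `a` in the `i`-th factor. -/
def stab (Γ : LGraph X) (i : Fin 2) (a : Γ.V) : Subgroup (PresentedGroup (R i)) where
  carrier := {g | Γ.HasFactorPath R i a g a}
  mul_mem' h h' := h.trans h'
  one_mem' := .refl R i a
  inv_mem' h := h.symm

theorem mem_stab : g ∈ Γ.stab R i a ↔ Γ.HasFactorPath R i a g a := Iff.rfl

end LGraph

open LGraph

variable {A : Type v} [Group A] {φ : ∀ i, A →* PresentedGroup (R i)}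

theorem exists_monoPath_val_eq_of {z : PushoutI φ} :
    (∃ w, Γ.HasMonoPath i a w b ∧ val φ w = z) ↔
      ∃ g, Γ.HasFactorPath R i a g b ∧ PushoutI.of (φ := φ) i g = z := by
  constructor
  · rintro ⟨w, ⟨hw, hl⟩, rfl⟩
    obtain ⟨u, rfl⟩ := exists_eq_map_letter hl
    exact ⟨_, ⟨u, hw, rfl⟩, (val_map_letter φ i u).symm⟩
  · rintro ⟨_, ⟨u, hu, rfl⟩, rfl⟩
    exact ⟨_, ⟨hu, fun _ => color_of_mem_map_letter⟩, val_map_letter φ i u⟩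

theorem mem_monoLab {z : PushoutI φ} :
    z ∈ monoLab φ Γ i a ↔ ∃ g ∈ Γ.stab R i a, PushoutI.of (φ := φ) i g = z :=
  exists_monoPath_val_eq_of

theorem mem_orbit (hφ : ∀ i, Function.Injective (φ i)) :
    b ∈ orbit φ Γ i a ↔ ∃ x, Γ.HasFactorPath R i a (φ i x) b := by
  constructor
  · rintro ⟨w, hw, hv⟩
    obtain ⟨g, hg, hz⟩ := (exists_monoPath_val_eq_of (φ := φ)).1 ⟨w, hw, rfl⟩
    obtain ⟨x, rfl⟩ := (of_mem_amal_iff hφ).1 (hz ▸ hv)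
    exact ⟨x, hg⟩
  · rintro ⟨x, hx⟩
    obtain ⟨w, hw, hv⟩ := (exists_monoPath_val_eq_of (φ := φ)).2 ⟨_, hx, rfl⟩
    exact ⟨w, hw, hv ▸ (of_mem_amal_iff hφ).2 ⟨x, rfl⟩⟩

theorem monoLab_subset_amal_iff (hφ : ∀ i, Function.Injective (φ i)) :
    monoLab φ Γ i a ⊆ amal φ ↔ Γ.stab R i a ≤ (φ i).range := by
  constructor
  · exact fun h g hg => (of_mem_amal_iff hφ).1 (h (mem_monoLab.2 ⟨g, hg, rfl⟩))
  · rintro h _ hz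
    obtain ⟨g, hg, rfl⟩ := mem_monoLab.1 hz
    exact (of_mem_amal_iff hφ).2 (h hg)

theorem monoLab_eq_one_iff (hφ : ∀ i, Function.Injective (φ i)) :
    monoLab φ Γ i a = {1} ↔ Γ.stab R i a = ⊥ := by
  have hmono : monoLab φ Γ i a = (Γ.stab R i a).map (PushoutI.of (φ := φ) i) :=
    Set.ext fun _ => mem_monoLab
  rw [hmono, ← Subgroup.coe_bot, SetLike.coe_set_eq,
    Subgroup.map_eq_bot_iff_of_injective _ (PushoutI.of_injective hφ i)]

end FactorPaths

open LGraph

section RelativeCayley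

variable {X : Fin 2 → Type u} {R : ∀ i, Set (FreeGroup (X i))} {i : Fin 2}

theorem coset_eq_iff {S : Subgroup (PresentedGroup (R i))} {g h : PresentedGroup (R i)} :
    coset S g = coset S h ↔ h * g⁻¹ ∈ S := by
  rw [← QuotientGroup.rightRel_apply]
  exact Quotient.eq

theorem coset_surjective (S : Subgroup (PresentedGroup (R i))) :
    Function.Surjective (coset S) := Quotient.mk_surjective

theorem relCayley_wellLabelled (S : Subgroup (PresentedGroup (R i))) :
    (relCayley S).WellLabelled := by
  rintro ⟨c, x⟩ ⟨d, y⟩ h h'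
  obtain rfl : c = d := h
  obtain rfl : x = y := letter_injective i h'
  rfl

theorem cayley_wellLabelled (R : ∀ i, Set (FreeGroup (X i))) (i : Fin 2) :
    (cayley R i).WellLabelled := by
  rintro ⟨g, x⟩ ⟨h, y⟩ hgh hxy
  obtain rfl : g = h := hgh
  obtain rfl : x = y := letter_injective i hxy
  rfl

/-- The left translation by `h`, an automorphism of the Cayley graph. -/
def cayleyTranslate (h : PresentedGroup (R i)) : (cayley R i).Hom (cayley R i) where
  onV := fun g : PresentedGroup (R i) => h * g
  onE p := (h * p.1, p.2)
  ini_onE _ := rfl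
  rev_onE p := Prod.ext (mul_assoc h p.1 (genVal R p.2)) rfl
  lab_onE _ := rfl

/-- The canonical morphism from the Cayley graph onto a relative Cayley graph. -/
def cosetHom (S : Subgroup (PresentedGroup (R i))) : (cayley R i).Hom (relCayley S) where
  onV := coset S
  onE p := (coset S p.1, p.2)
  ini_onE _ := rfl
  rev_onE _ := rfl
  lab_onE _ := rfl

/-- The morphism from a relative Cayley graph of `S` that is induced by a morphism from the Cayley
graph which is constant on the right cosets of `S`. -/
def relCayleyLift {Δ : LGraph X} (hΔ : Δ.WellLabelled) (f : (cayley R i).Hom Δ)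
    (S : Subgroup (PresentedGroup (R i)))
    (hS : ∀ g h : PresentedGroup (R i), h * g⁻¹ ∈ S → f.onV g = f.onV h) :
    (relCayley S).Hom Δ where
  onV := Quotient.lift f.onV fun g h hgh => hS g h (QuotientGroup.rightRel_apply.1 hgh)
  onE p := Quotient.lift (fun g => f.onE (g, p.2))
    (fun g h hgh => hΔ _ _
      ((f.ini_onE (g, p.2)).trans ((hS g h (QuotientGroup.rightRel_apply.1 hgh)).trans
        (f.ini_onE (h, p.2)).symm)) ((f.lab_onE (g, p.2)).trans (f.lab_onE (h, p.2)).symm)) p.1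
  ini_onE p := by
    obtain ⟨c, x⟩ := p
    induction c using Quotient.inductionOn with
    | h g => exact f.ini_onE (g, x)
  rev_onE p := by
    obtain ⟨c, x⟩ := p
    induction c using Quotient.inductionOn with
    | h g => exact f.rev_onE (g, x)
  lab_onE p := by
    obtain ⟨c, x⟩ := p
    induction c using Quotient.inductionOn with
    | h g => exact f.lab_onE (g, x)

theorem cayley_hasPath (h : PresentedGroup (R i)) (u : List (X i × Bool)) :
    (cayley R i).HasPath h (u.map (letter i)) (h * (u.map (genVal R)).prod) := by
  induction u generalizing h with
  | nil => simpa using HasPath.nil (Γ := cayley R i) h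
  | cons x u ih =>
    have := HasPath.cons (Γ := cayley R i) (h, x) (ih (h * genVal R x))
    rwa [mul_assoc] at this

theorem cayley_hasFactorPath (h g : PresentedGroup (R i)) :
    (cayley R i).HasFactorPath R i h g (h * g) := by
  obtain ⟨u, rfl⟩ := exists_prod_genVal_eq g
  exact ⟨u, cayley_hasPath h u, rfl⟩

end RelativeCayley

/-! ### Coverings by Cayley graphs -/

section Covers

variable {X : Fin 2 → Type u} {R : ∀ i, Set (FreeGroup (X i))} {Γ Δ : LGraph X} {i j : Fin 2}
  {a b c : Γ.V} {g h : PresentedGroup (R i)}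

theorem LGraph.Hom.hasFactorPath_iff (hΓ : Γ.WellLabelled) (f : (cayley R i).Hom Γ) :
    Γ.HasFactorPath R i (f.onV h) g b ↔ b = f.onV (h * g) := by
  constructor
  · rintro ⟨u, hu, rfl⟩
    exact hΓ.hasPath_unique hu ((cayley_hasPath h u).map f)
  · rintro rfl
    exact HasFactorPath.map f (cayley_hasFactorPath h g)

theorem LGraph.Hom.onV_eq_onV_iff (hΓ : Γ.WellLabelled) (f : (cayley R i).Hom Γ) :
    f.onV g = f.onV h ↔ h * g⁻¹ ∈ Γ.stab R i (f.onV (1 : PresentedGroup (R i))) := by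
  have hg : Γ.HasFactorPath R i (f.onV g) g⁻¹ (f.onV (1 : PresentedGroup (R i))) :=
    (f.hasFactorPath_iff hΓ).2 (by rw [mul_inv_cancel])
  have hh : Γ.HasFactorPath R i (f.onV (1 : PresentedGroup (R i))) h (f.onV h) :=
    (f.hasFactorPath_iff hΓ).2 (by rw [one_mul])
  rw [mem_stab]
  constructor
  · intro H
    exact hh.trans (H ▸ hg)
  · intro H
    have := (f.hasFactorPath_iff hΓ).1 (H.trans hg.symm)
    rwa [one_mul, inv_inv, inv_mul_cancel_right] at this

theorem stab_relCayley (S : Subgroup (PresentedGroup (R i))) :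
    (relCayley S).stab R i (coset S 1) = S := by
  ext g
  have := (cosetHom S).hasFactorPath_iff (relCayley_wellLabelled S) (h := 1) (g := g)
    (b := coset S 1)
  rw [one_mul] at this
  refine this.trans (coset_eq_iff.trans ?_)
  rw [inv_one, mul_one]

namespace LGraph

variable (R) in
/-- Some morphism from the Cayley graph of the `i`-th factor maps `1` to `a`. -/
def IsCoveredAt (Γ : LGraph X) (i : Fin 2) (a : Γ.V) : Prop :=
  ∃ f : (cayley R i).Hom Γ, f.onV (1 : PresentedGroup (R i)) = a

theorem isCoveredAt_onV (f : (cayley R i).Hom Γ) (h : PresentedGroup (R i)) :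
    Γ.IsCoveredAt R i (f.onV h) :=
  ⟨f.comp (cayleyTranslate h), congrArg f.onV (mul_one h)⟩

theorem IsCoveredAt.map (f : Γ.Hom Δ) (h : Γ.IsCoveredAt R i a) :
    Δ.IsCoveredAt R i (f.onV a) := by
  obtain ⟨m, rfl⟩ := h
  exact ⟨f.comp m, rfl⟩

theorem IsCoveredAt.of_factorPath (hΓ : Γ.WellLabelled) (ha : Γ.IsCoveredAt R i a)
    (H : Γ.HasFactorPath R i a g b) : Γ.IsCoveredAt R i b := by
  obtain ⟨f, rfl⟩ := ha
  exact (f.hasFactorPath_iff hΓ).1 H ▸ isCoveredAt_onV f _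

end LGraph

variable (R) in
/-- A well-labelled graph all of whose monochromatic components are quotients of Cayley graphs. -/
structure Cover (Γ : LGraph X) : Prop where
  wellLabelled : Γ.WellLabelled
  isCoveredAt : ∀ i a, Γ.Inc i a → Γ.IsCoveredAt R i a

namespace Cover

theorem of_exists (hΓ : Γ.WellLabelled)
    (h : ∀ e, ∃ a ∈ Γ.compV e, Γ.IsCoveredAt R (Γ.color e) a) : Cover R Γ := by
  refine ⟨hΓ, ?_⟩
  rintro _ _ ⟨e, rfl, rfl⟩
  obtain ⟨a, ha, hcov⟩ := h e
  obtain ⟨g, hg⟩ := exists_factorPath_of_mem_compV R ha (ini_mem_compV e)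
  exact hcov.of_factorPath hΓ hg

theorem exists_factorPath (hΓ : Cover R Γ) (ha : Γ.Inc i a) (g : PresentedGroup (R i)) :
    ∃ b, Γ.HasFactorPath R i a g b := by
  obtain ⟨f, rfl⟩ := hΓ.isCoveredAt i a ha
  exact ⟨_, (f.hasFactorPath_iff hΓ.wellLabelled).2 rfl⟩

theorem eq_of_factorPath_one (hΓ : Cover R Γ) (h : Γ.HasFactorPath R i a 1 b) : a = b := by
  by_cases ha : Γ.Inc i a
  · obtain ⟨f, rfl⟩ := hΓ.isCoveredAt i a ha
    rw [f.hasFactorPath_iff hΓ.wellLabelled, mul_one] at h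
    exact h.symm
  · obtain ⟨_ | ⟨x, u⟩, hu, -⟩ := h
    · cases hu; rfl
    · obtain ⟨e, he, hl, -⟩ := hasPath_cons_iff.1 hu
      exact absurd ⟨e, he, congrArg Letter.color hl⟩ ha

theorem unique (hΓ : Cover R Γ) (h : Γ.HasFactorPath R i a g b)
    (h' : Γ.HasFactorPath R i a g c) : b = c :=
  hΓ.eq_of_factorPath_one (by simpa using h.symm.trans h')

theorem exists_iso_cayley (hΓ : Cover R Γ) (hc : Γ.Connected) (hi : ∀ e, Γ.color e = i)
    (ha : Γ.Inc i a) (hs : Γ.stab R i a = ⊥) :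
    ∃ F : Γ.Iso (cayley R i), F.onV a = (1 : PresentedGroup (R i)) := by
  obtain ⟨f, rfl⟩ := hΓ.isCoveredAt i a ha
  have hinj : Function.Injective f.onV := fun g h hgh => by
    have hmem := (f.onV_eq_onV_iff hΓ.wellLabelled).1 hgh
    rw [hs] at hmem
    exact (mul_inv_eq_one.1 (Subgroup.mem_bot.1 hmem)).symm
  have hsurj : Function.Surjective f.onV := fun b => by
    obtain ⟨w, hw⟩ := hc.2 (f.onV (1 : PresentedGroup (R i))) b
    obtain ⟨g, hg⟩ := (hw.hasMonoPath hi).exists_factorPath R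
    exact ⟨_, ((f.hasFactorPath_iff hΓ.wellLabelled).1 hg).symm⟩
  have hsurjE : Function.Surjective f.onE := fun e => by
    obtain ⟨g, hg⟩ := hsurj (Γ.ini e)
    obtain ⟨x, hx⟩ := Letter.exists_eq_letter (hi e)
    exact ⟨(g, x), hΓ.wellLabelled _ _ ((f.ini_onE (g, x)).trans hg)
      ((f.lab_onE (g, x)).trans hx.symm)⟩
  let F := Iso.ofBijective f ⟨hinj, hsurj⟩
    ⟨f.onE_injective (cayley_wellLabelled R i) hinj, hsurjE⟩
  exact ⟨F.symm, F.onV.symm_apply_apply _⟩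

end Cover

end Covers

section Components

variable {X : Fin 2 → Type u} {R : ∀ i, Set (FreeGroup (X i))} {Γ Δ : LGraph X} {e : Γ.E}
  {a b t : Γ.V}

theorem comp_wellLabelled (hΓ : Γ.WellLabelled) (e : Γ.E) : (Γ.comp e).WellLabelled :=
  fun _ _ h h' => Subtype.ext (hΓ _ _ (congrArg Subtype.val h) h')

theorem LGraph.HasPath.exists_comp {w : List (Letter X)} (h : Γ.HasPath a w b)
    (hw : ∀ l ∈ w, l.color = Γ.color e) (ha : a ∈ Γ.compV e) :
    ∃ hb : b ∈ Γ.compV e, (Γ.comp e).HasPath ⟨a, ha⟩ w ⟨b, hb⟩ := by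
  induction h with
  | nil a => exact ⟨ha, .nil _⟩
  | cons f _ ih =>
    have hf : f ∈ Γ.compE e := ⟨hw _ List.mem_cons_self, ha⟩
    obtain ⟨hb, hp⟩ := ih (fun l hl => hw l (List.mem_cons_of_mem _ hl)) (ter_mem_compV hf)
    exact ⟨hb, HasPath.cons (Γ := Γ.comp e) ⟨f, hf⟩ hp⟩

variable (R) in
theorem stab_comp (ht : t ∈ Γ.compV e) :
    (Γ.comp e).stab R (Γ.color e) ⟨t, ht⟩ = Γ.stab R (Γ.color e) t := by
  ext g
  constructor
  · exact fun h => HasFactorPath.map (Γ.compHom e) h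
  · rintro ⟨u, hu, hg⟩
    exact ⟨u, (hu.exists_comp (fun _ => color_of_mem_map_letter) ht).2, hg⟩

theorem stab_iso (f : Γ.Iso Δ) (i : Fin 2) (a : Γ.V) :
    Δ.stab R i (f.onV a) = Γ.stab R i a := by
  ext g
  constructor
  · intro h
    have := HasFactorPath.map f.symm.toHom h
    rwa [show f.symm.toHom.onV (f.onV a) = a from f.onV.symm_apply_apply a] at this
  · exact fun h => HasFactorPath.map f.toHom h

/-- The covering of the component of `e` that is induced by a morphism from a Cayley graph. -/
def LGraph.Hom.toCompOfMem (f : (cayley R (Γ.color e)).Hom Γ)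
    (hf : f.onV (1 : PresentedGroup (R (Γ.color e))) ∈ Γ.compV e) :
    (cayley R (Γ.color e)).Hom (Γ.comp e) :=
  f.toComp e (fun g : PresentedGroup (R (Γ.color e)) =>
    HasFactorPath.mem_compV (one_mul g ▸ HasFactorPath.map f (cayley_hasFactorPath 1 g)) hf)
    fun _ => rfl

theorem CompIso.of_bijective {S : Subgroup (PresentedGroup (R (Γ.color e)))}
    (hΓ : Γ.WellLabelled) (f : (relCayley S).Hom (Γ.comp e)) (hV : Function.Bijective f.onV) :
    CompIso Γ e (f.onV (coset S 1)).1 S := by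
  have hE : Function.Surjective f.onE := fun e' => by
    obtain ⟨c, hc⟩ := hV.2 ((Γ.comp e).ini e')
    obtain ⟨x, hx⟩ := Letter.exists_eq_letter (l := (Γ.comp e).lab e') e'.2.1
    refine ⟨(c, x), comp_wellLabelled hΓ e _ _ ?_ ?_⟩
    · exact (f.ini_onE (c, x)).trans hc
    · exact (f.lab_onE (c, x)).trans hx.symm
  let F := Iso.ofBijective f hV ⟨f.onE_injective (relCayley_wellLabelled S) hV.1, hE⟩
  exact ⟨F.symm, (f.onV (coset S 1)).2, F.onV.symm_apply_apply (coset S 1)⟩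

theorem Cover.compIso_stab (hΓ : Cover R Γ) (ht : t ∈ Γ.compV e) :
    CompIso Γ e t (Γ.stab R (Γ.color e) t) := by
  obtain ⟨f, rfl⟩ := hΓ.isCoveredAt _ _ (inc_of_mem_compV ht)
  set t := f.onV (1 : PresentedGroup (R (Γ.color e)))
  have hS (g h : PresentedGroup (R (Γ.color e))) :
      f.onV g = f.onV h ↔ h * g⁻¹ ∈ Γ.stab R (Γ.color e) t := f.onV_eq_onV_iff hΓ.wellLabelled
  let F := relCayleyLift (comp_wellLabelled hΓ.wellLabelled e) (f.toCompOfMem ht)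
    (Γ.stab R (Γ.color e) t) fun g h hgh => Subtype.ext ((hS g h).2 hgh)
  refine CompIso.of_bijective hΓ.wellLabelled F ⟨?_, ?_⟩
  · intro c d hcd
    obtain ⟨g, rfl⟩ := coset_surjective _ c
    obtain ⟨h, rfl⟩ := coset_surjective _ d
    exact coset_eq_iff.2 ((hS g h).1 (congrArg Subtype.val hcd))
  · rintro ⟨a, ha⟩
    obtain ⟨g, hg⟩ := exists_factorPath_of_mem_compV R ht ha
    rw [f.hasFactorPath_iff hΓ.wellLabelled, one_mul] at hg
    exact ⟨coset _ g, Subtype.ext hg.symm⟩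

theorem Cover.compIso_iff (hΓ : Cover R Γ) {S : Subgroup (PresentedGroup (R (Γ.color e)))} :
    CompIso Γ e t S ↔ t ∈ Γ.compV e ∧ S = Γ.stab R (Γ.color e) t := by
  constructor
  · rintro ⟨f, ht, hf⟩
    refine ⟨ht, (stab_relCayley S).symm.trans ?_⟩
    exact hf ▸ (stab_iso f _ _).trans (stab_comp R ht)
  · rintro ⟨ht, rfl⟩
    exact hΓ.compIso_stab ht

end Components

/-! ### Normal forms and closed paths -/

section NormalForms

variable {X : Fin 2 → Type u} {R : ∀ i, Set (FreeGroup (X i))} {A : Type v} [Group A]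
  {φ : ∀ i, A →* PresentedGroup (R i)} {Γ : LGraph X} {i j : Fin 2} {a b : Γ.V}
  {s t : Σ i, PresentedGroup (R i)} {l l' : List (Σ i, PresentedGroup (R i))}

variable (φ) in
/-- At every bichromatic vertex the amalgamated subgroup acts in the same way through both
factors: this is what the identifications of step 4 achieve. -/
def NoConflict (Γ : LGraph X) : Prop :=
  ∀ d ∈ Γ.VB, ∀ i j x b c, i ≠ j → Γ.HasFactorPath R i d (φ i x) b →
    Γ.HasFactorPath R j d (φ j x) c → b = c

theorem Cover.inc_and_factorPath_of_noConflict (hΓ : Cover R Γ) (hn : NoConflict φ Γ) {x : A}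
    (hij : i ≠ j) (ha : Γ.Inc i a) (h : Γ.HasFactorPath R i a (φ i x) b)
    (hj : Γ.Inc j a ∨ Γ.Inc j b) : Γ.Inc j a ∧ Γ.HasFactorPath R j a (φ j x) b := by
  rcases hj with hj | hj
  · obtain ⟨c, hc⟩ := hΓ.exists_factorPath hj (φ j x)
    exact ⟨hj, hn a (mem_VB_of_ne hij ha hj) i j x b c hij h hc ▸ hc⟩
  · obtain ⟨c, hc⟩ := hΓ.exists_factorPath hj (φ j x⁻¹)
    have h' : Γ.HasFactorPath R i b (φ i x⁻¹) a := map_inv (φ i) x ▸ h.symm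
    obtain rfl := hn b (mem_VB_of_ne hij (h.inc ha) hj) i j x⁻¹ a c hij h' hc
    exact ⟨hc.inc hj, by simpa using hc.symm⟩

/-- Paths that are divided into monochromatic pieces, each starting at a vertex of its colour; the
list contains the elements of the factors that the pieces represent. -/
inductive SyllablePath (Γ : LGraph X) : Γ.V → List (Σ i, PresentedGroup (R i)) → Γ.V → Prop
  | nil (a : Γ.V) : SyllablePath Γ a [] a
  | cons {a b c : Γ.V} {s : Σ i, PresentedGroup (R i)} {l : List (Σ i, PresentedGroup (R i))}
      (ha : Γ.Inc s.1 a) (h : Γ.HasFactorPath R s.1 a s.2 b) (hl : SyllablePath Γ b l c) :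
      SyllablePath Γ a (s :: l) c

variable (φ) in
/-- The element of the amalgam represented by a list of elements of the factors. -/
def syllableVal (l : List (Σ i, PresentedGroup (R i))) : PushoutI φ :=
  (l.map fun s => PushoutI.of (φ := φ) s.1 s.2).prod

variable (φ) in
/-- Two adjacent syllables that can be replaced with a single one, because they belong to the same
factor or because one of them belongs to the amalgamated subgroup. -/
def Mergeable (s t : Σ i, PresentedGroup (R i)) : Prop :=
  s.1 = t.1 ∨ s.2 ∈ (φ s.1).range ∨ t.2 ∈ (φ t.1).range

variable (φ) in
theorem LGraph.HasPath.exists_syllablePath {w : List (Letter X)} (h : Γ.HasPath a w b) :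
    ∃ l : List (Σ i, PresentedGroup (R i)), SyllablePath Γ a l b ∧ syllableVal φ l = val φ w := by
  induction h with
  | nil a => exact ⟨[], .nil a, by simp [syllableVal]⟩
  | cons e _ ih =>
    obtain ⟨l, hl, hv⟩ := ih
    obtain ⟨x, hx⟩ := Letter.exists_eq_letter (i := Γ.color e) (l := Γ.lab e) rfl
    refine ⟨⟨Γ.color e, genVal R x⟩ :: l, .cons (inc_ini e) (.edge e hx) hl, ?_⟩
    rw [val_cons, hx, val_letter, ← hv]
    simp [syllableVal]

theorem SyllablePath.merge_head (hΓ : Cover R Γ) (hn : NoConflict φ Γ) (hst : Mergeable φ s t)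
    (h : SyllablePath Γ a (s :: t :: l) b) :
    ∃ r, SyllablePath Γ a (r :: l) b ∧ syllableVal φ (r :: l) = syllableVal φ (s :: t :: l) := by
  obtain ⟨i, g⟩ := s
  obtain ⟨j, k⟩ := t
  cases h with
  | cons ha h hl =>
  cases hl with
  | cons hb h' hl =>
  simp only at ha h hb h'
  obtain rfl | hij := eq_or_ne i j
  · exact ⟨⟨i, g * k⟩, .cons ha (h.trans h') hl, by simp [syllableVal, mul_assoc]⟩
  rcases hst with hst | ⟨x, hx⟩ | ⟨x, hx⟩
  · exact absurd hst hij
  · obtain rfl : φ i x = g := hx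
    obtain ⟨ha', h⟩ := hΓ.inc_and_factorPath_of_noConflict hn hij ha h (.inr hb)
    refine ⟨⟨j, φ j x * k⟩, .cons ha' (h.trans h') hl, ?_⟩
    simp [syllableVal, mul_assoc, PushoutI.of_apply_eq_base]
  · obtain rfl : φ j x = k := hx
    obtain ⟨-, h'⟩ := hΓ.inc_and_factorPath_of_noConflict hn hij.symm hb h' (.inl (h.inc ha))
    refine ⟨⟨i, g * φ i x⟩, .cons ha (h.trans h') hl, ?_⟩
    simp [syllableVal, mul_assoc, PushoutI.of_apply_eq_base]

theorem SyllablePath.merge (hΓ : Cover R Γ) (hn : NoConflict φ Γ) (hst : Mergeable φ s t)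
    (h : SyllablePath Γ a (l' ++ s :: t :: l) b) :
    ∃ r, SyllablePath Γ a (l' ++ r :: l) b ∧
      syllableVal φ (l' ++ r :: l) = syllableVal φ (l' ++ s :: t :: l) := by
  induction l' generalizing a with
  | nil => exact h.merge_head hΓ hn hst
  | cons q l' ih =>
    cases h with
    | cons ha h hl =>
    obtain ⟨r, hr, hv⟩ := ih hl
    refine ⟨r, .cons ha h hr, ?_⟩
    simp only [syllableVal, List.cons_append, List.map_cons, List.prod_cons] at hv ⊢
    rw [hv]

theorem notMem_range_of_isChain_not_mergeable
    (h : (s :: t :: l).IsChain fun s t => ¬ Mergeable φ s t) :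
    ∀ r ∈ s :: t :: l, r.2 ∉ (φ r.1).range := by
  induction l generalizing s t with
  | nil =>
    obtain ⟨hst, -⟩ := List.isChain_cons_cons.1 h
    simp only [Mergeable, not_or] at hst
    simpa using hst.2
  | cons q l ih =>
    obtain ⟨hst, htl⟩ := List.isChain_cons_cons.1 h
    exact List.forall_mem_cons.2 ⟨fun hs => hst (.inr (.inl hs)), ih htl⟩

theorem syllableVal_ne_one (hφ : ∀ i, Function.Injective (φ i))
    (h : (s :: t :: l).IsChain fun s t => ¬ Mergeable φ s t) :
    syllableVal φ (s :: t :: l) ≠ 1 := by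
  have hr := notMem_range_of_isChain_not_mergeable h
  let w : Monoid.CoprodI.Word fun i => PresentedGroup (R i) :=
    { toList := s :: t :: l
      ne_one := fun r hm h1 => hr r hm (h1 ▸ one_mem _)
      chain_ne := h.imp fun _ _ hst hne => hst (.inl hne) }
  intro hv
  have hw : (PushoutI.ofCoprodI w.prod : PushoutI φ) = syllableVal φ (s :: t :: l) := by
    rw [Monoid.CoprodI.Word.prod, map_list_prod, syllableVal, List.map_map]
    exact congrArg _ (List.map_congr_left fun r _ => PushoutI.ofCoprodI_of _ _)
  have hempty := PushoutI.Reduced.eq_empty_of_mem_range hφ (w := w) hr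
    (by rw [hw, hv]; exact one_mem _)
  exact List.cons_ne_nil _ _ (congrArg Monoid.CoprodI.Word.toList hempty)

theorem SyllablePath.eq_of_syllableVal_eq_one (hφ : ∀ i, Function.Injective (φ i))
    (hΓ : Cover R Γ) (hn : NoConflict φ Γ) (h : SyllablePath Γ a l b)
    (hv : syllableVal φ l = 1) : a = b := by
  induction hk : l.length using Nat.strong_induction_on generalizing l with
  | _ k ih =>
    by_cases hl : l.IsChain fun s t => ¬ Mergeable φ s t
    · match l with
      | [] => cases h; rfl
      | [s] =>
        cases h with
        | cons _ h hl =>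
        cases hl
        have hs : s.2 = 1 := PushoutI.of_injective hφ s.1 (by simpa [syllableVal] using hv)
        exact hΓ.eq_of_factorPath_one (hs ▸ h)
      | s :: t :: l => exact absurd hv (syllableVal_ne_one hφ hl)
    · simp only [List.isChain_iff_forall_rel_of_append_cons_cons, not_forall, not_not] at hl
      obtain ⟨s, t, l₁, l₂, rfl, hst⟩ := hl
      obtain ⟨r, hr, hv'⟩ := h.merge hΓ hn hst
      exact ih _ (by simp [← hk]) hr (hv'.trans hv) rfl

theorem Cover.gBased (hφ : ∀ i, Function.Injective (φ i)) (hΓ : Cover R Γ)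
    (hn : NoConflict φ Γ) : GBased φ Γ := by
  intro a b w hw hv
  obtain ⟨l, hl, hlv⟩ := hw.exists_syllablePath φ
  exact hl.eq_of_syllableVal_eq_one hφ hΓ hn (hlv.trans hv)

end NormalForms

section FoldedPrecovers

variable {X : Fin 2 → Type u} {R : ∀ i, Set (FreeGroup (X i))} {A : Type v} [Group A]
  {φ : ∀ i, A →* PresentedGroup (R i)}

theorem Cover.ncard_orbit {Γ : LGraph X} {i : Fin 2} {t : Γ.V}
    (hφ : ∀ i, Function.Injective (φ i)) (hΓ : Cover R Γ) (ht : Γ.Inc i t) :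
    (orbit φ Γ i t).ncard = (Γ.stab R i t).relIndex (φ i).range := by
  obtain ⟨f, rfl⟩ := hΓ.isCoveredAt _ _ ht
  set S := Γ.stab R i (f.onV (1 : PresentedGroup (R i)))
  let F : (φ i).range → Γ.V := fun g => f.onV (g : PresentedGroup (R i))
  have hker : Setoid.ker F = QuotientGroup.rightRel (S.subgroupOf (φ i).range) :=
    Setoid.ext fun g h => by
      rw [QuotientGroup.rightRel_apply]
      exact f.onV_eq_onV_iff hΓ.wellLabelled
  have hrange : orbit φ Γ i (f.onV (1 : PresentedGroup (R i))) = Set.range F := by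
    ext b
    simp only [mem_orbit hφ, f.hasFactorPath_iff hΓ.wellLabelled, one_mul]
    constructor
    · rintro ⟨x, rfl⟩
      exact ⟨⟨φ i x, x, rfl⟩, rfl⟩
    · rintro ⟨⟨_, x, rfl⟩, rfl⟩
      exact ⟨x, rfl⟩
  rw [hrange, ← Nat.card_coe_set_eq, ← Nat.card_congr (Setoid.quotientKerEquivRange F), hker]
  exact Nat.card_congr (QuotientGroup.quotientRightRelEquivQuotientLeftRel _)

theorem GBased.eq_of_factorPath {Γ : LGraph X} {i j : Fin 2} {a b c : Γ.V} {x : A}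
    (hΓ : GBased φ Γ) (hb : Γ.HasFactorPath R i a (φ i x) b)
    (hc : Γ.HasFactorPath R j a (φ j x) c) : b = c := by
  obtain ⟨w, hw, hv⟩ := (exists_monoPath_val_eq_of (φ := φ)).2 ⟨_, hb, rfl⟩
  obtain ⟨w', hw', hv'⟩ := (exists_monoPath_val_eq_of (φ := φ)).2 ⟨_, hc, rfl⟩
  refine hΓ b c _ (hw.reverse.1.append hw'.1) ?_
  rw [val_append, val_reverse, hv, hv', PushoutI.of_apply_eq_base, PushoutI.of_apply_eq_base,
    inv_mul_cancel]

variable (φ) in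
/-- A well-labelled precover, with the covering condition expressed by morphisms from Cayley
graphs. -/
structure FoldedPrecover (Γ : LGraph X) : Prop where
  cover : Cover R Γ
  gBased : GBased φ Γ
  connected : Γ.Connected

namespace FoldedPrecover

theorem isPrecover {Γ : LGraph X} (hΓ : FoldedPrecover φ Γ) : IsPrecover φ Γ :=
  ⟨hΓ.connected, hΓ.gBased, fun e =>
    ⟨_, (hΓ.cover.compIso_stab (ini_mem_compV e)).nonempty⟩⟩

theorem factorPath_other {Γ : LGraph X} {i j : Fin 2} {a b : Γ.V} {x : A}
    (hΓ : FoldedPrecover φ Γ) (ha : Γ.Inc j a) (h : Γ.HasFactorPath R i a (φ i x) b) :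
    Γ.HasFactorPath R j a (φ j x) b := by
  obtain ⟨c, hc⟩ := hΓ.cover.exists_factorPath ha (φ j x)
  rwa [hΓ.gBased.eq_of_factorPath h hc]

variable {Γ : PGraph X} {e : Γ.E} {a b t : Γ.V}

theorem orbit_subset_compVB (hφ : ∀ i, Function.Injective (φ i))
    (hΓ : FoldedPrecover φ Γ.toLGraph) (ht : t ∈ Γ.compVB e) :
    orbit φ Γ.toLGraph (Γ.color e) t ⊆ Γ.compVB e := by
  intro b hb
  obtain ⟨x, hx⟩ := (mem_orbit hφ).1 hb
  exact ⟨hx.mem_compV ht.1, fun j => (hΓ.factorPath_other (ht.2 j) hx).inc (ht.2 j)⟩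

theorem removable (hφ : ∀ i, Function.Injective (φ i)) (hΓ : FoldedPrecover φ Γ.toLGraph)
    (ht : t ∈ Γ.compVB e)
    (hs : Γ.stab R (Γ.color e) t ≤ (φ (Γ.color e)).range)
    (ho : Γ.compVB e = orbit φ Γ.toLGraph (Γ.color e) t)
    (hb : Γ.base ∉ Γ.compV e ∨ (Γ.base ∈ Γ.compVB e ∧ Γ.stab R (Γ.color e) t = ⊥)) :
    Removable φ Γ e := by
  refine ⟨t, ht, _, hs, hΓ.cover.compIso_stab ht.1, ?_, ?_⟩
  · rw [ho, hΓ.cover.ncard_orbit hφ (inc_of_mem_compV ht.1)]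
  · rcases hb with hb | ⟨hb, hs⟩
    · by_cases hs : Γ.stab R (Γ.color e) t = ⊥
      · exact .inl ⟨hs, fun h => hb h.1⟩
      · exact .inr ⟨hs, hb⟩
    · refine .inl ⟨hs, fun h => ?_⟩
      obtain ⟨f, hf, hc⟩ := hb.2 (1 - Γ.color e)
      have := hc.symm.trans (h.2 f hf)
      omega

theorem mem_range_of_removable (hφ : ∀ i, Function.Injective (φ i)) [Finite Γ.V]
    (hΓ : FoldedPrecover φ Γ.toLGraph) (h : Removable φ Γ e) (ha : a ∈ Γ.compVB e)
    (hb : b ∈ Γ.compVB e) {g : PresentedGroup (R (Γ.color e))}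
    (hg : Γ.HasFactorPath R (Γ.color e) a g b) : g ∈ (φ (Γ.color e)).range := by
  obtain ⟨t, ht, K, hK, hi, hcard, -⟩ := h
  obtain ⟨-, rfl⟩ := hΓ.cover.compIso_iff.1 hi
  have ho : orbit φ Γ.toLGraph (Γ.color e) t = Γ.compVB e := by
    refine Set.eq_of_subset_of_ncard_le (hΓ.orbit_subset_compVB hφ ht) ?_ (Set.toFinite _)
    rw [hcard, hΓ.cover.ncard_orbit hφ (inc_of_mem_compV ht.1)]
  rw [← ho, mem_orbit hφ] at ha hb
  obtain ⟨x, hx⟩ := ha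
  obtain ⟨y, hy⟩ := hb
  obtain ⟨z, hz⟩ := hK ((hx.trans hg).trans hy.symm)
  refine ⟨x⁻¹ * z * y, ?_⟩
  rw [map_mul, map_mul, hz, map_inv]
  group

theorem monoLab_inter_amal_subset (hφ : ∀ i, Function.Injective (φ i))
    (hΓ : FoldedPrecover φ Γ.toLGraph) (i : Fin 2) {j : Fin 2} (ha : Γ.Inc j a) :
    monoLab φ Γ.toLGraph i a ∩ amal φ ⊆ monoLab φ Γ.toLGraph j a ∩ amal φ := by
  rintro z ⟨hz, hz'⟩
  refine ⟨?_, hz'⟩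
  obtain ⟨g, hg, rfl⟩ := mem_monoLab.1 hz
  obtain ⟨x, rfl⟩ := (of_mem_amal_iff hφ).1 hz'
  refine mem_monoLab.2 ⟨φ j x, hΓ.factorPath_other ha hg, ?_⟩
  rw [PushoutI.of_apply_eq_base, PushoutI.of_apply_eq_base]

theorem exists_other_component (hφ : ∀ i, Function.Injective (φ i))
    (hΓ : FoldedPrecover φ Γ.toLGraph) (ha : a ∈ Γ.VB) (i : Fin 2) :
    ∃ f : Γ.E, Γ.color f ≠ i ∧ a ∈ Γ.compV f ∧
      monoLab φ Γ.toLGraph i a ∩ amal φ = monoLab φ Γ.toLGraph (Γ.color f) a ∩ amal φ := by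
  obtain ⟨f, hf, hc⟩ := ha (1 - i)
  exact ⟨f, by omega, hf ▸ ini_mem_compV f,
    (hΓ.monoLab_inter_amal_subset hφ _ (ha _)).antisymm (hΓ.monoLab_inter_amal_subset hφ _ (ha i))⟩

end FoldedPrecover

end FoldedPrecovers

/-! ### Graphs that determine a subgroup -/

section Sound

variable {X : Fin 2 → Type u} {R : ∀ i, Set (FreeGroup (X i))} {A : Type v} [Group A]
  (φ : ∀ i, A →* PresentedGroup (R i)) (H : Subgroup (PushoutI φ))

/-- A morphism from `Γ` to the coset graph of `H`: reading the label of a path from `a` to `b`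
multiplies `p b` by the element that the label represents and gives `p a`. -/
def IsPotential (Γ : LGraph X) (p : Γ.V → PushoutI φ ⧸ H) : Prop :=
  ∀ e, p (Γ.ini e) = val φ [Γ.lab e] • p (Γ.ter e)

/-- A finite connected graph in which the paths closed at the basepoint represent the elements of
`H`. The potential bounds `Lab φ Γ` from above, in a form that is local and survives gluing. -/
structure Sound (Γ : PGraph X) : Prop where
  finite_V : Finite Γ.V
  finite_E : Finite Γ.E
  connected : Γ.Connected
  subset_lab : (H : Set (PushoutI φ)) ⊆ Lab φ Γ
  exists_potential : ∃ p, IsPotential φ H Γ.toLGraph p ∧ p Γ.base = QuotientGroup.mk 1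

variable {φ H} {Γ Δ : PGraph X}

theorem IsPotential.eq_smul {Γ : LGraph X} {p : Γ.V → PushoutI φ ⧸ H}
    (hp : IsPotential φ H Γ p) {a b : Γ.V} {w : List (Letter X)} (h : Γ.HasPath a w b) :
    p a = val φ w • p b := by
  induction h with
  | nil a => rw [val_nil, one_smul]
  | cons e _ ih => rw [hp e, ih, smul_smul, ← val_cons]

theorem IsPotential.eq_of_smul {Γ : LGraph X} {i : Fin 2} {p : Γ.V → PushoutI φ ⧸ H}
    (hp : IsPotential φ H Γ p) {a b : Γ.V} {g : PresentedGroup (R i)}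
    (h : Γ.HasFactorPath R i a g b) : p a = PushoutI.of (φ := φ) i g • p b := by
  obtain ⟨u, hu, rfl⟩ := h
  rw [hp.eq_smul hu, val_map_letter]

theorem Sound.lab_eq (h : Sound φ H Γ) : Lab φ Γ = H := by
  refine Set.Subset.antisymm ?_ h.subset_lab
  rintro _ ⟨w, hw, rfl⟩
  obtain ⟨p, hp, hb⟩ := h.exists_potential
  have := hp.eq_smul hw
  rw [hb, MulAction.Quotient.smul_mk, QuotientGroup.eq] at this
  simpa using this

theorem Lab.map (f : Γ.Hom Δ.toLGraph) (hb : f.onV Γ.base = Δ.base) : Lab φ Γ ⊆ Lab φ Δ := by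
  rintro _ ⟨w, hw, rfl⟩
  exact ⟨w, hb ▸ hw.map f, rfl⟩

namespace Sound

theorem fold (h : Sound φ H Γ) {e f : Γ.E} (hef : Γ.Foldable e f) :
    Sound φ H (Γ.fold e f hef) where
  finite_V := have := h.finite_V; inferInstanceAs (Finite (Quot _))
  finite_E := have := h.finite_E; inferInstanceAs (Finite (Quot _))
  connected := h.connected.of_surjective (Γ.identEdgesHom e f hef.lab_eq) Quot.mk_surjective
  subset_lab := h.subset_lab.trans (Lab.map (Γ.identEdgesHom e f hef.lab_eq) rfl)
  exists_potential := by
    obtain ⟨p, hp, hp1⟩ := h.exists_potential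
    refine ⟨Quot.lift p ?_, Quot.ind hp, hp1⟩
    rintro a b (⟨rfl, rfl⟩ | ⟨rfl, rfl⟩)
    · rw [hef.ini_eq]
    · have := hp e
      rw [hef.ini_eq, hp f, hef.lab_eq] at this
      exact (MulAction.injective _ this).symm

theorem identify (h : Sound φ H Γ) {c a b : Γ.V} (hc : Conflict φ Γ.toLGraph c a b) :
    Sound φ H (Γ.identify a b) where
  finite_V := have := h.finite_V; inferInstanceAs (Finite (Quot _))
  finite_E := h.finite_E
  connected := h.connected.of_surjective (Γ.identVertsHom _) Quot.mk_surjective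
  subset_lab := h.subset_lab.trans (Lab.map (Γ.identVertsHom _) rfl)
  exists_potential := by
    obtain ⟨p, hp, hp1⟩ := h.exists_potential
    refine ⟨Quot.lift p ?_, hp, hp1⟩
    rintro _ _ ⟨rfl, rfl⟩
    obtain ⟨-, w, w', hw, hw', -, -, hv⟩ := hc
    have := hp.eq_smul hw.1
    rw [hp.eq_smul hw'.1, hv] at this
    exact (MulAction.injective _ this).symm

end Sound

section GlueCayley

/-- The signed generator that labels the edge `e`. -/
def LGraph.gen (Γ : LGraph X) (e : Γ.E) : X (Γ.color e) × Bool := ((Γ.lab e).1.2, (Γ.lab e).2)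

variable (R Γ) (e : Γ.E)

/-- The canonical morphism onto `glueCayley R Γ e` from the disjoint union. -/
def glueCayleyHom : (Γ.disjUnion (cayley R (Γ.color e))).Hom (glueCayley R Γ e).toLGraph :=
  (Γ.disjUnion (cayley R (Γ.color e))).identEdgesHom (Sum.inl e)
    (Sum.inr ((1 : PresentedGroup (R (Γ.color e))), Γ.gen e)) rfl

/-- The morphism from the original graph to the graph with a Cayley graph glued on. -/
def glueCayleyInl : Γ.Hom (glueCayley R Γ e).toLGraph :=
  (glueCayleyHom R Γ e).comp (Γ.inlHom (cayley R (Γ.color e)))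

/-- The morphism from the Cayley graph that is glued on. -/
def glueCayleyInr : (cayley R (Γ.color e)).Hom (glueCayley R Γ e).toLGraph :=
  (glueCayleyHom R Γ e).comp (Γ.inrHom (cayley R (Γ.color e)))

theorem glueCayleyInr_one : (glueCayleyInr R Γ e).onV (1 : PresentedGroup (R (Γ.color e))) =
    (glueCayleyInl R Γ e).onV (Γ.ini e) :=
  (Quot.sound (r := (Γ.disjUnion (cayley R (Γ.color e))).EdgeRelV (Sum.inl e)
    (Sum.inr ((1 : PresentedGroup (R (Γ.color e))), Γ.gen e))) (Or.inl ⟨rfl, rfl⟩)).symm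

variable {R Γ}

theorem LGraph.Connected.glueCayley (h : Γ.Connected) : (glueCayley R Γ e).Connected := by
  refine connected_of_forall_hasPath ((glueCayleyInl R Γ e).onV (Γ.ini e)) ?_
  rintro ⟨a | (g : PresentedGroup (R (Γ.color e)))⟩
  · obtain ⟨w, hw⟩ := h.2 (Γ.ini e) a
    exact ⟨w, hw.map (glueCayleyInl R Γ e)⟩
  · obtain ⟨u, hu, -⟩ := HasFactorPath.map (glueCayleyInr R Γ e) (cayley_hasFactorPath 1 g)
    rw [one_mul] at hu
    exact ⟨_, glueCayleyInr_one R Γ e ▸ hu⟩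

theorem IsPotential.exists_glueCayley {p : Γ.V → PushoutI φ ⧸ H}
    (hp : IsPotential φ H Γ.toLGraph p) :
    ∃ q, IsPotential φ H (glueCayley R Γ e).toLGraph q ∧
      ∀ a, q ((glueCayleyInl R Γ e).onV a) = p a := by
  let q : Γ.V ⊕ PresentedGroup (R (Γ.color e)) → PushoutI φ ⧸ H :=
    Sum.elim p fun g => (PushoutI.of (φ := φ) (Γ.color e) g)⁻¹ • p (Γ.ini e)
  refine ⟨Quot.lift q ?_, ?_, fun _ => rfl⟩
  · rintro _ _ (⟨rfl, rfl⟩ | ⟨rfl, rfl⟩)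
    · change p (Γ.ini e) = (PushoutI.of (φ := φ) (Γ.color e) 1)⁻¹ • p (Γ.ini e)
      rw [map_one, inv_one, one_smul]
    · change p (Γ.ter e) =
        (PushoutI.of (φ := φ) (Γ.color e) (1 * genVal R (Γ.gen e)))⁻¹ • p (Γ.ini e)
      have hx : val φ [Γ.lab e] = PushoutI.of (φ := φ) (Γ.color e) (genVal R (Γ.gen e)) :=
        val_letter φ (Γ.color e) (Γ.gen e)
      rw [one_mul, ← hx, hp e, inv_smul_smul]
  · rintro ⟨a | ⟨g, x⟩⟩
    · exact hp a
    · change (PushoutI.of (φ := φ) (Γ.color e) g)⁻¹ • p (Γ.ini e) =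
        val φ [letter (Γ.color e) x] •
          (PushoutI.of (φ := φ) (Γ.color e) (g * genVal R x))⁻¹ • p (Γ.ini e)
      rw [val_letter, smul_smul, map_mul, mul_inv_rev, mul_inv_cancel_left]

theorem Sound.glueCayley [∀ i, Finite (X i)] [∀ i, Finite (PresentedGroup (R i))]
    (h : Sound φ H Γ) : Sound φ H (glueCayley R Γ e) where
  finite_V :=
    have := h.finite_V
    have : Finite (Γ.disjUnion (cayley R (Γ.color e))).V :=
      inferInstanceAs (Finite (Γ.V ⊕ PresentedGroup (R (Γ.color e))))
    .of_surjective (glueCayleyHom R Γ e).onV Quot.mk_surjective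
  finite_E :=
    have := h.finite_E
    have : Finite (Γ.disjUnion (cayley R (Γ.color e))).E := inferInstanceAs
      (Finite (Γ.E ⊕ PresentedGroup (R (Γ.color e)) × (X (Γ.color e) × Bool)))
    .of_surjective (glueCayleyHom R Γ e).onE Quot.mk_surjective
  connected := h.connected.glueCayley e
  subset_lab := h.subset_lab.trans (Lab.map (glueCayleyInl R Γ e) rfl)
  exists_potential := by
    obtain ⟨p, hp, hp1⟩ := h.exists_potential
    obtain ⟨q, hq, hqp⟩ := hp.exists_glueCayley e
    exact ⟨q, hq, (hqp Γ.base).trans hp1⟩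

end GlueCayley

end Sound

/-! ### Removing hairs and components -/

section Retractions

variable {X : Fin 2 → Type u} {R : ∀ i, Set (FreeGroup (X i))} {A : Type v} [Group A]
  {φ : ∀ i, A →* PresentedGroup (R i)} {H : Subgroup (PushoutI φ)}

variable (φ) in
/-- A retraction of `Γ` onto the subgraph `Δ` that sends edges to paths. The vertex `a` is moved
to `onV a` along an imaginary path from `onV a` to `a` that represents `shift a`. -/
structure Retraction {Γ Δ : LGraph X} (f : Δ.Hom Γ) where
  onV : Γ.V → Δ.V
  shift : Γ.V → PushoutI φ
  onV_apply : ∀ a, onV (f.onV a) = a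
  shift_apply : ∀ a, shift (f.onV a) = 1
  exists_path : ∀ e, ∃ w, Δ.HasPath (onV (Γ.ini e)) w (onV (Γ.ter e)) ∧
    val φ w * shift (Γ.ter e) = shift (Γ.ini e) * val φ [Γ.lab e]

theorem Retraction.exists_hasPath {Γ Δ : LGraph X} {f : Δ.Hom Γ} (r : Retraction φ f) {a b : Γ.V}
    {w : List (Letter X)} (h : Γ.HasPath a w b) :
    ∃ w', Δ.HasPath (r.onV a) w' (r.onV b) ∧ val φ w' * r.shift b = r.shift a * val φ w := by
  induction h with
  | nil a => exact ⟨[], .nil _, by simp⟩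
  | cons e _ ih =>
    obtain ⟨w, hw, hv⟩ := ih
    obtain ⟨u, hu, hv'⟩ := r.exists_path e
    exact ⟨u ++ w, hu.append hw, by
      rw [val_append, mul_assoc, hv, ← mul_assoc, hv', mul_assoc, ← val_cons]⟩

theorem Retraction.exists_hasPath_of_onV {Γ Δ : LGraph X} {f : Δ.Hom Γ} (r : Retraction φ f)
    {a b : Δ.V} {w : List (Letter X)} (h : Γ.HasPath (f.onV a) w (f.onV b)) :
    ∃ w', Δ.HasPath a w' b ∧ val φ w' = val φ w := by
  simpa only [r.onV_apply, r.shift_apply, mul_one, one_mul] using r.exists_hasPath h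

variable {Γ Δ : PGraph X}

theorem Sound.of_retraction (h : Sound φ H Γ) (f : Δ.Hom Γ.toLGraph)
    (hV : Function.Injective f.onV) (hE : Function.Injective f.onE) (hb : f.onV Δ.base = Γ.base)
    (r : Retraction φ f) : Sound φ H Δ where
  finite_V := have := h.finite_V; .of_injective _ hV
  finite_E := have := h.finite_E; .of_injective _ hE
  connected := ⟨⟨Δ.base⟩, fun a b => by
    obtain ⟨w, hw⟩ := h.connected.2 (f.onV a) (f.onV b)
    obtain ⟨w', hw', -⟩ := r.exists_hasPath_of_onV hw
    exact ⟨w', hw'⟩⟩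
  subset_lab x hx := by
    obtain ⟨w, hw, rfl⟩ := h.subset_lab hx
    exact r.exists_hasPath_of_onV (hb ▸ hw)
  exists_potential := by
    obtain ⟨p, hp, hp1⟩ := h.exists_potential
    refine ⟨p ∘ f.onV, fun e => ?_, by rw [Function.comp_apply, hb, hp1]⟩
    have := hp (f.onE e)
    rwa [f.ini_onE, f.ter_onE, f.lab_onE] at this

section CutHair

variable {e : Γ.E} (he : Γ.IsHair e)

/-- The inclusion of the graph with a hair cut. -/
def cutHairHom : (Γ.cutHair e he).Hom Γ.toLGraph where
  onV := Subtype.val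
  onE := Subtype.val
  ini_onE _ := rfl
  rev_onE _ := rfl
  lab_onE _ := rfl

theorem PGraph.IsHair.ini_ne_ter (he : Γ.IsHair e) : Γ.ini e ≠ Γ.ter e := fun h =>
  Γ.rev_ne e (he.eq_rev h).symm

variable (φ) in
theorem PGraph.IsHair.exists_retraction : Nonempty (Retraction φ (cutHairHom he)) := by
  classical
  let r (a : Γ.V) : (Γ.cutHair e he).V :=
    if ha : a = Γ.ter e then ⟨Γ.ini e, he.ini_ne_ter⟩ else ⟨a, ha⟩
  let s (a : Γ.V) : PushoutI φ := if a = Γ.ter e then val φ [Γ.lab e] else 1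
  have hr : r (Γ.ter e) = r (Γ.ini e) := (dif_pos rfl).trans (dif_neg he.ini_ne_ter).symm
  have hs : s (Γ.ter e) = val φ [Γ.lab e] := if_pos rfl
  have hr' {a : Γ.V} (ha : a ≠ Γ.ter e) : r a = ⟨a, ha⟩ := dif_neg ha
  have hs' {a : Γ.V} (ha : a ≠ Γ.ter e) : s a = 1 := if_neg ha
  refine ⟨⟨r, s, fun a => hr' a.2, fun a => hs' a.2, fun f => ?_⟩⟩
  rcases eq_or_ne f e with rfl | hfe
  · exact ⟨[], hr ▸ .nil _, by rw [hs, hs' he.ini_ne_ter, val_nil]⟩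
  rcases eq_or_ne f (Γ.rev e) with rfl | hfr
  · rw [Γ.ter_rev, hs' he.ini_ne_ter, Γ.lab_rev, val_inv]
    exact ⟨[], hr ▸ .nil _, by rw [val_nil, ← hs]; exact (mul_inv_cancel _).symm⟩
  have hi : Γ.ini f ≠ Γ.ter e := fun h => hfr (he.eq_rev h)
  have ht : Γ.ter f ≠ Γ.ter e := fun h => hfe (by rw [← Γ.rev_rev f, he.eq_rev h, Γ.rev_rev])
  rw [hr' hi, hr' ht, hs' hi, hs' ht]
  exact ⟨_, .edge (Γ := (Γ.cutHair e he).toLGraph) ⟨f, hfe, hfr⟩,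
    (mul_one _).trans (one_mul _).symm⟩

theorem Sound.cutHair (h : Sound φ H Γ) : Sound φ H (Γ.cutHair e he) :=
  h.of_retraction (cutHairHom he) Subtype.val_injective Subtype.val_injective rfl
    (he.exists_retraction φ).some

end CutHair

section RemoveComp

theorem LGraph.notMem_compVM_of_inc {Γ : LGraph X} {e : Γ.E} {a : Γ.V} {j : Fin 2}
    (ha : Γ.Inc j a) (hj : j ≠ Γ.color e) : a ∉ Γ.compVM e := by
  obtain ⟨f, hf, hc⟩ := ha
  exact fun h => hj (hc.symm.trans (h.2 f hf))

theorem LGraph.notMem_compVM_of_mem_VB {Γ : LGraph X} {e : Γ.E} {a : Γ.V} (ha : a ∈ Γ.VB) :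
    a ∉ Γ.compVM e :=
  notMem_compVM_of_inc (ha (1 - Γ.color e)) (by omega)

theorem LGraph.mem_compVB_of_notMem_compVM {Γ : LGraph X} {e : Γ.E} {a : Γ.V}
    (ha : a ∈ Γ.compV e) (ha' : a ∉ Γ.compVM e) : a ∈ Γ.compVB e := by
  refine ⟨ha, ?_⟩
  by_contra h
  refine ha' ⟨ha, fun f hf => ?_⟩
  by_contra hc
  exact h (mem_VB_of_ne hc ⟨f, hf, rfl⟩ (inc_of_mem_compV ha))

variable {e : Γ.E} (he : Γ.base ∉ Γ.compVM e)

/-- The inclusion of the graph with a component removed. -/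
def removeCompHom : (Γ.removeComp e he).Hom Γ.toLGraph where
  onV := Subtype.val
  onE := Subtype.val
  ini_onE _ := rfl
  rev_onE _ := rfl
  lab_onE _ := rfl

theorem LGraph.HasPath.removeComp {j : Fin 2} {a b : Γ.V} {w : List (Letter X)}
    (hw : Γ.HasPath a w b) (hl : ∀ l ∈ w, l.color = j) (hj : j ≠ Γ.color e)
    (ha : a ∉ Γ.compVM e) (hb : b ∉ Γ.compVM e) :
    (Γ.removeComp e he).HasPath ⟨a, ha⟩ w ⟨b, hb⟩ := by
  induction hw with
  | nil a => exact .nil _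
  | cons f _ ih =>
    obtain rfl : Γ.color f = j := hl _ List.mem_cons_self
    exact .cons (Γ := (Γ.removeComp e he).toLGraph) ⟨f, fun h => hj h.1⟩
      (ih (fun l hm => hl l (List.mem_cons_of_mem _ hm)) (notMem_compVM_of_inc (inc_ter f) hj) hb)

theorem FoldedPrecover.exists_detour (hφ : ∀ i, Function.Injective (φ i)) [Finite Γ.V]
    (hΓ : FoldedPrecover φ Γ.toLGraph) (hr : Removable φ Γ e) {a b : Γ.V}
    (ha : a ∈ Γ.compVB e) (hb : b ∈ Γ.compVB e) {g : PresentedGroup (R (Γ.color e))}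
    (hg : Γ.HasFactorPath R (Γ.color e) a g b) :
    ∃ w, (Γ.removeComp e he).HasPath ⟨a, notMem_compVM_of_mem_VB ha.2⟩ w
      ⟨b, notMem_compVM_of_mem_VB hb.2⟩ ∧ val φ w = PushoutI.of (φ := φ) (Γ.color e) g := by
  obtain ⟨x, rfl⟩ := hΓ.mem_range_of_removable hφ hr ha hb hg
  obtain ⟨u, hu, hux⟩ := hΓ.factorPath_other (ha.2 (1 - Γ.color e)) hg
  refine ⟨_, hu.removeComp he (fun _ => color_of_mem_map_letter) (by omega) _ _, ?_⟩
  rw [val_map_letter, hux, PushoutI.of_apply_eq_base, PushoutI.of_apply_eq_base]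

theorem Removable.exists_center (hr : Removable φ Γ e) (a : Γ.V) :
    ∃ d, ∃ _ : d ∉ Γ.compVM e, ∃ g, Γ.HasFactorPath R (Γ.color e) d g a ∧
      (a ∉ Γ.compVM e → d = a ∧ g = 1) := by
  obtain ⟨t, ht, -⟩ := hr
  by_cases ha : a ∈ Γ.compVM e
  · obtain ⟨g, hg⟩ := exists_factorPath_of_mem_compV R ht.1 ha.1
    exact ⟨t, notMem_compVM_of_mem_VB ht.2, g, hg, fun h => absurd ha h⟩
  · exact ⟨a, ha, 1, .refl R _ a, fun _ => ⟨rfl, rfl⟩⟩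

theorem FoldedPrecover.exists_retraction (hφ : ∀ i, Function.Injective (φ i)) [Finite Γ.V]
    (hΓ : FoldedPrecover φ Γ.toLGraph) (hr : Removable φ Γ e) :
    Nonempty (Retraction φ (removeCompHom he)) := by
  choose d hd g hg hdg using hr.exists_center
  let r (a : Γ.V) : (Γ.removeComp e he).V := ⟨d a, hd a⟩
  have hr {a : Γ.V} (ha : a ∉ Γ.compVM e) : r a = ⟨a, ha⟩ := Subtype.ext (hdg a ha).1
  have hg1 {a : Γ.V} (ha : a ∉ Γ.compVM e) : PushoutI.of (φ := φ) (Γ.color e) (g a) = 1 := by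
    rw [(hdg a ha).2, map_one]
  refine ⟨⟨r, fun a => PushoutI.of (φ := φ) _ (g a), fun a => hr a.2, fun a => hg1 a.2,
    fun f => ?_⟩⟩
  by_cases hf : f ∈ Γ.compE e
  · have hB {a : Γ.V} (ha : a ∈ Γ.compV e) : d a ∈ Γ.compVB e :=
      mem_compVB_of_notMem_compVM ((hg a).symm.mem_compV ha) (hd a)
    obtain ⟨x, hx⟩ := Letter.exists_eq_letter (l := Γ.lab f) hf.1
    obtain ⟨w, hw, hv⟩ := hΓ.exists_detour he hφ ‹_› (hB hf.2) (hB (ter_mem_compV hf))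
      (((hg (Γ.ini f)).trans (.edge f hx)).trans (hg (Γ.ter f)).symm)
    exact ⟨w, hw, by simp [hv, hx, val_letter]⟩
  · let f' : (Γ.removeComp e he).E := ⟨f, hf⟩
    have hi : Γ.ini f ∉ Γ.compVM e := ((Γ.removeComp e he).ini f').2
    have ht : Γ.ter f ∉ Γ.compVM e := ((Γ.removeComp e he).ter f').2
    rw [hr hi, hr ht, hg1 hi, hg1 ht]
    exact ⟨_, .edge f', (mul_one _).trans (one_mul _).symm⟩

theorem Sound.removeComp (hφ : ∀ i, Function.Injective (φ i)) (h : Sound φ H Γ)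
    (hΓ : FoldedPrecover φ Γ.toLGraph) (hr : Removable φ Γ e) :
    Sound φ H (Γ.removeComp e he) :=
  have := h.finite_V
  h.of_retraction (removeCompHom he) Subtype.val_injective Subtype.val_injective rfl
    (hΓ.exists_retraction he hφ hr).some

theorem LGraph.mem_compV_of_monoPath {Γ : LGraph X} {e : Γ.E} {a b : Γ.V} (ha : a ∈ Γ.compV e)
    (h : ∃ w, Γ.HasMonoPath (Γ.color e) a w b) : b ∈ Γ.compV e := by
  obtain ⟨w, hw⟩ := ha
  obtain ⟨w', hw'⟩ := h
  exact ⟨_, hw.append hw'⟩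

theorem Cover.removeComp (hΓ : Cover R Γ.toLGraph) : Cover R (Γ.removeComp e he).toLGraph where
  wellLabelled f f' h h' := Subtype.ext (hΓ.wellLabelled _ _ (congrArg Subtype.val h) h')
  isCoveredAt := by
    rintro _ _ ⟨⟨f, hf⟩, rfl, rfl⟩
    obtain ⟨m, hm⟩ := hΓ.isCoveredAt (Γ.color f) (Γ.ini f) (inc_ini f)
    have hpath (g : PresentedGroup (R (Γ.color f))) :
        Γ.HasFactorPath R (Γ.color f) (Γ.ini f) g (m.onV g) := by
      simpa [hm] using HasFactorPath.map m (cayley_hasFactorPath 1 g)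
    have hV (g : PresentedGroup (R (Γ.color f))) (hc : Γ.color f = Γ.color e) :
        m.onV g ∉ Γ.compV e := fun hg => by
      exact hf ⟨hc, mem_compV_of_monoPath hg (hc ▸ (hpath g).symm.exists_monoPath)⟩
    have hVM (g : PresentedGroup (R (Γ.color f))) : m.onV g ∉ Γ.compVM e := fun hg =>
      notMem_compVM_of_inc ((hpath g).inc (inc_ini f)) (fun hc => hV g hc hg.1) hg
    exact ⟨
      { onV := fun g => ⟨m.onV g, hVM g⟩
        onE := fun p => ⟨m.onE p, fun hp => hV p.1 ((m.color_onE p).symm.trans hp.1)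
          (m.ini_onE p ▸ hp.2)⟩
        ini_onE := fun p => Subtype.ext (m.ini_onE p)
        rev_onE := fun p => Subtype.ext (m.rev_onE p)
        lab_onE := fun p => m.lab_onE p }, Subtype.ext hm⟩

theorem FoldedPrecover.removeComp (hΓ : FoldedPrecover φ Γ.toLGraph)
    (hc : (Γ.removeComp e he).Connected) :
    FoldedPrecover φ (Γ.removeComp e he).toLGraph where
  cover := hΓ.cover.removeComp he
  gBased _ _ w hw hv := Subtype.ext (hΓ.gBased _ _ w (hw.map (removeCompHom he)) hv)
  connected := hc

end RemoveComp

section Trivial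

theorem trivial_connected : (PGraph.trivial X).Connected :=
  ⟨⟨PUnit.unit⟩, fun _ _ => ⟨[], .nil _⟩⟩

variable (φ) in
theorem trivial_foldedPrecover : FoldedPrecover φ (PGraph.trivial X).toLGraph where
  cover := ⟨fun e => e.elim, by rintro _ _ ⟨e, -⟩; exact e.elim⟩
  gBased _ _ _ _ _ := rfl
  connected := trivial_connected

theorem val_eq_one_of_hasPath_cayley {i : Fin 2} {g : PresentedGroup (R i)}
    {w : List (Letter X)} (h : (cayley R i).HasPath g w g) : val φ w = 1 := by
  obtain ⟨k, hk, hv⟩ :=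
    (exists_monoPath_val_eq_of (φ := φ)).1 ⟨w, h.hasMonoPath fun _ => rfl, rfl⟩
  have hgk : coset (R := R) ⊥ g = coset ⊥ (g * k) :=
    ((cosetHom ⊥).hasFactorPath_iff (relCayley_wellLabelled ⊥)).1 (hk.map (cosetHom ⊥))
  rw [coset_eq_iff, Subgroup.mem_bot, mul_inv_eq_one, mul_eq_left] at hgk
  rw [← hv, hgk, map_one]

theorem Sound.trivial (h : Sound φ H Γ) (hc : IsCayley R Γ) : Sound φ H (PGraph.trivial X) where
  finite_V := inferInstanceAs (Finite PUnit)
  finite_E := inferInstanceAs (Finite PEmpty)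
  connected := trivial_connected
  subset_lab x hx := by
    obtain ⟨w, hw, rfl⟩ := h.subset_lab hx
    obtain ⟨-, i, f, -⟩ := hc
    exact ⟨[], .nil _, by rw [val_nil, val_eq_one_of_hasPath_cayley (hw.map f.toHom)]⟩
  exists_potential := ⟨fun _ => QuotientGroup.mk 1, fun e => e.elim, rfl⟩

end Trivial

end Retractions

/-! ### The bouquet of the input and the invariants of steps 3 and 4 -/

section Bouquet

variable {X : Fin 2 → Type u} {R : ∀ i, Set (FreeGroup (X i))} {A : Type v} [Group A]
  {φ : ∀ i, A →* PresentedGroup (R i)} {H : Subgroup (PushoutI φ)} {ws : List (List (Letter X))}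

theorem Lab.closure_subset {Γ : PGraph X} {s : Set (PushoutI φ)} (h : s ⊆ Lab φ Γ) :
    (Subgroup.closure s : Set (PushoutI φ)) ⊆ Lab φ Γ := by
  intro g hg
  induction hg using Subgroup.closure_induction with
  | mem g hg => exact h hg
  | one => exact ⟨[], .nil _, val_nil φ⟩
  | mul _ _ _ _ hg hg' =>
    obtain ⟨w, hw, rfl⟩ := hg
    obtain ⟨w', hw', rfl⟩ := hg'
    exact ⟨_, hw.append hw', val_append φ w w'⟩
  | inv _ _ hg =>
    obtain ⟨w, hw, rfl⟩ := hg
    exact ⟨_, hw.reverse, val_reverse φ w⟩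

theorem IsPotential.of_forall_or {Γ : LGraph X} {p : Γ.V → PushoutI φ ⧸ H}
    (h : ∀ e, p (Γ.ini e) = val φ [Γ.lab e] • p (Γ.ter e) ∨
      p (Γ.ter e) = val φ [Γ.lab (Γ.rev e)] • p (Γ.ini e)) : IsPotential φ H Γ p := by
  intro e
  rcases h e with h | h
  · exact h
  · rw [h, Γ.lab_rev, val_inv, smul_inv_smul]

namespace PGraph

theorem bouquetNode_zero (j : Fin ws.length) : bouquetNode ws j 0 = none := by
  simp [bouquetNode]

theorem bouquetNode_length (j : Fin ws.length) : bouquetNode ws j (ws.get j).length = none := by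
  simp [bouquetNode]

theorem bouquet_hasPath_take (j : Fin ws.length) {k : ℕ} (hk : k ≤ (ws.get j).length) :
    (bouquet ws).HasPath (bouquet ws).base ((ws.get j).take k) ⟨bouquetNode ws j k⟩ := by
  induction k with
  | zero =>
    rw [bouquetNode_zero]
    exact .nil _
  | succ k ih =>
    rw [← List.take_concat_get' _ _ hk]
    exact (ih (Nat.le_of_succ_le hk)).snoc (Γ := (bouquet ws).toLGraph) ⟨(⟨j, ⟨k, hk⟩⟩, true)⟩ rfl

variable (ws)

theorem finite_bouquet_V : Finite (bouquet ws).V := by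
  have : Finite {p : Fin ws.length × ℕ // 0 < p.2 ∧ p.2 < (ws.get p.1).length} :=
    .of_injective (β := Σ j : Fin ws.length, Fin (ws.get j).length)
      (fun p => ⟨p.1.1, ⟨p.1.2, p.2.2⟩⟩) <| by
        rintro ⟨⟨j, k⟩, hk⟩ ⟨⟨j', k'⟩, hk'⟩ h
        simp only [Sigma.mk.injEq] at h
        obtain ⟨rfl, h⟩ := h
        simpa using h
  exact inferInstanceAs (Finite (ULift (Option _)))

theorem bouquet_connected : (bouquet ws).Connected := by
  refine connected_of_forall_hasPath (bouquet ws).base ?_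
  rintro ⟨_ | ⟨⟨j, k⟩, hk⟩⟩
  · exact ⟨[], .nil _⟩
  · have := bouquet_hasPath_take j hk.2.le
    rw [bouquetNode, dif_pos hk] at this
    exact ⟨_, this⟩

theorem exists_bouquet_potential (hH : ∀ w ∈ ws, val φ w ∈ H) :
    ∃ p, IsPotential φ H (bouquet ws).toLGraph p ∧ p (bouquet ws).base = QuotientGroup.mk 1 := by
  let q (j : Fin ws.length) (k : ℕ) : PushoutI φ ⧸ H :=
    (val φ ((ws.get j).take k))⁻¹ • QuotientGroup.mk 1
  let p (a : (bouquet ws).V) : PushoutI φ ⧸ H :=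
    a.down.elim (QuotientGroup.mk 1) fun x => q x.1.1 x.1.2
  have hq_length (j : Fin ws.length) : q j (ws.get j).length = QuotientGroup.mk 1 := by
    simp only [q]
    rw [List.take_length, MulAction.Quotient.smul_mk, QuotientGroup.eq]
    simpa using hH _ (List.get_mem ws j)
  have hp (j : Fin ws.length) (k : ℕ) (hk : k ≤ (ws.get j).length) :
      p ⟨bouquetNode ws j k⟩ = q j k := by
    rcases Nat.eq_zero_or_pos k with rfl | hk₀
    · simp [p, q, bouquetNode_zero]
    rcases hk.eq_or_lt with rfl | hk₁
    · rw [bouquetNode_length, hq_length]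
      rfl
    · rw [bouquetNode, dif_pos ⟨hk₀, hk₁⟩]
      rfl
  have hq (j : Fin ws.length) (k : Fin (ws.get j).length) :
      q j k = val φ [(ws.get j).get k] • q j (k + 1) := by
    simp only [q]
    rw [← List.take_concat_get' _ _ k.2, val_append, mul_inv_rev, smul_smul]
    exact congrArg (· • _) (mul_inv_cancel_left _ _).symm
  have hedge (j : Fin ws.length) (k : Fin (ws.get j).length) : p ⟨bouquetNode ws j k⟩ =
      val φ [(ws.get j).get k] • p ⟨bouquetNode ws j (k + 1)⟩ := by
    rw [hp j k k.2.le, hq, hp j _ k.2]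
  refine ⟨p, .of_forall_or ?_, rfl⟩
  rintro ⟨⟨j, k⟩, _ | _⟩
  · exact .inr (hedge j k)
  · exact .inl (hedge j k)

end PGraph

open PGraph

variable (φ ws) in
theorem sound_bouquet : Sound φ (Subgroup.closure {g | ∃ w ∈ ws, val φ w = g}) (bouquet ws) where
  finite_V := finite_bouquet_V ws
  finite_E := inferInstanceAs
    (Finite (ULift ((Σ j : Fin ws.length, Fin (ws.get j).length) × Bool)))
  connected := bouquet_connected ws
  subset_lab := Lab.closure_subset <| by
    rintro _ ⟨w, hw, rfl⟩
    obtain ⟨j, rfl⟩ := List.get_of_mem hw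
    have := bouquet_hasPath_take j le_rfl
    rw [bouquetNode_length, List.take_length] at this
    exact ⟨_, this, rfl⟩
  exists_potential := exists_bouquet_potential ws fun w hw =>
    Subgroup.subset_closure ⟨w, hw, rfl⟩

end Bouquet

section Steps

variable {X : Fin 2 → Type u} {R : ∀ i, Set (FreeGroup (X i))} {A : Type v} [Group A]
  {φ : ∀ i, A →* PresentedGroup (R i)} {Γ Δ : LGraph X}

theorem eq_or_of_quot_mk_eq {α : Type*} {r : α → α → Prop} {x y : α}
    (hr : ∀ a b, r a b → a = b ∨ (a = x ∧ b = y)) {a b : α} (h : Quot.mk r a = Quot.mk r b) :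
    a = b ∨ ((a = x ∨ a = y) ∧ (b = x ∨ b = y)) := by
  replace h := Quot.eqvGen_exact h
  induction h with
  | rel a b h => exact (hr a b h).imp_right fun h => ⟨.inl h.1, .inr h.2⟩
  | refl a => exact .inl rfl
  | symm a b _ ih => exact ih.imp Eq.symm And.symm
  | trans a b c _ _ ih ih' => grind

variable (R) in
/-- The invariant of step 3: every monochromatic component is covered by a Cayley graph or
contains one of the edges that still have to be processed. -/
def CoveredOrListed (Γ : LGraph X) (L : List Γ.E) : Prop :=
  ∀ e, ∃ a ∈ Γ.compV e,
    Γ.IsCoveredAt R (Γ.color e) a ∨ ∃ f ∈ L, Γ.ini f = a ∧ Γ.color f = Γ.color e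

namespace CoveredOrListed

theorem of_picksEdges {L : List Γ.E} (hL : PicksEdges Γ L) : CoveredOrListed R Γ L := by
  intro e
  obtain ⟨k, hk, -⟩ := hL e
  exact ⟨_, hk.2, .inr ⟨_, List.get_mem L k, rfl, hk.1⟩⟩

theorem map {L : List Γ.E} (h : CoveredOrListed R Γ L) (f : Γ.Hom Δ)
    (hf : Function.Surjective f.onE) : CoveredOrListed R Δ (L.map f.onE) := by
  intro e
  obtain ⟨e, rfl⟩ := hf e
  obtain ⟨a, ha, hL⟩ := h e
  refine ⟨f.onV a, mem_compV_map f ha, ?_⟩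
  rw [f.color_onE]
  refine hL.imp (fun h => h.map f) ?_
  rintro ⟨e', he', rfl, hc⟩
  exact ⟨f.onE e', List.mem_map_of_mem he', f.ini_onE e', by rw [f.color_onE, hc]⟩

theorem glueCayley {Γ : PGraph X} {e : Γ.E} {L : List Γ.E}
    (h : CoveredOrListed R Γ.toLGraph (e :: L)) :
    CoveredOrListed R (glueCayley R Γ e).toLGraph (L.map (glueCayleyE R Γ e)) := by
  let f := glueCayleyInl R Γ e
  rintro ⟨d | ⟨g, x⟩⟩
  · obtain ⟨a, ha, hL⟩ := h d
    refine ⟨f.onV a, mem_compV_map f ha, ?_⟩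
    rcases hL with h | ⟨e', he', rfl, hc⟩
    · exact .inl (h.map f)
    rcases List.mem_cons.1 he' with rfl | he'
    · have := isCoveredAt_onV (glueCayleyInr R Γ e') 1
      rw [glueCayleyInr_one] at this
      exact .inl (hc ▸ this)
    · exact .inr ⟨f.onE e', List.mem_map_of_mem he', rfl, hc⟩
  · exact ⟨_, ini_mem_compV _, .inl (isCoveredAt_onV (glueCayleyInr R Γ e) g)⟩

theorem cover (h : CoveredOrListed R Γ []) (hΓ : Γ.WellLabelled) : Cover R Γ :=
  .of_exists hΓ fun e => (h e).imp fun _ ⟨ha, hL⟩ => ⟨ha, hL.resolve_right (by simp)⟩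

end CoveredOrListed

variable (φ) in
/-- The vertices `c · x` with `c ∈ B` and `x ∈ A`, where the translate is read in both colours. -/
def biorbit (Γ : LGraph X) (B : Set Γ.V) : Set Γ.V :=
  {d | ∃ c ∈ B, ∃ x : A, ∀ i, Γ.HasFactorPath R i c (φ i x) d}

theorem subset_biorbit (B : Set Γ.V) : B ⊆ biorbit φ Γ B :=
  fun d hd => ⟨d, hd, 1, fun i => by rw [map_one]; exact .refl R i d⟩

theorem mem_biorbit_map (f : Γ.Hom Δ) {B : Set Γ.V} {d : Γ.V} (hd : d ∈ biorbit φ Γ B) :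
    f.onV d ∈ biorbit φ Δ (f.onV '' B) := by
  obtain ⟨c, hc, x, hx⟩ := hd
  exact ⟨_, ⟨c, hc, rfl⟩, x, fun i => (hx i).map f⟩

theorem LGraph.Hom.exists_inc_of_surjective (f : Γ.Hom Δ) (hf : Function.Surjective f.onE)
    {i : Fin 2} {d : Δ.V} (hd : Δ.Inc i d) : ∃ a, Γ.Inc i a ∧ f.onV a = d := by
  obtain ⟨e, rfl, rfl⟩ := hd
  obtain ⟨e, rfl⟩ := hf e
  exact ⟨Γ.ini e, f.color_onE e ▸ inc_ini e, (f.ini_onE e).symm⟩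

theorem VB_subset_biorbit_map (f : Γ.Hom Δ) (hf : Function.Surjective f.onE) {B : Set Γ.V}
    (hB : Γ.VB ⊆ biorbit φ Γ B)
    (h : ∀ a b, Γ.Inc 0 a → Γ.Inc 1 b → f.onV a = f.onV b →
      a ∈ Γ.VB ∨ b ∈ Γ.VB ∨ f.onV a ∈ biorbit φ Δ (f.onV '' B)) :
    Δ.VB ⊆ biorbit φ Δ (f.onV '' B) := by
  intro d hd
  obtain ⟨a, ha, rfl⟩ := f.exists_inc_of_surjective hf (hd 0)
  obtain ⟨b, hb, hab⟩ := f.exists_inc_of_surjective hf (hd 1)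
  rcases h a b ha hb hab.symm with h | h | h
  · exact mem_biorbit_map f (hB h)
  · exact hab ▸ mem_biorbit_map f (hB h)
  · exact h

theorem VB_fold_subset_biorbit {Γ : PGraph X} {B : Set Γ.V} (hB : Γ.VB ⊆ biorbit φ Γ.toLGraph B)
    {e f : Γ.E} (hef : Γ.Foldable e f) :
    (Γ.fold e f hef).VB ⊆ biorbit φ (Γ.fold e f hef).toLGraph (Γ.foldV e f hef '' B) := by
  refine VB_subset_biorbit_map (Γ.identEdgesHom e f hef.lab_eq) Quot.mk_surjective hB
    fun a b ha hb hab => ?_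
  have hcf : Γ.color f = Γ.color e := congrArg Letter.color hef.lab_eq.symm
  have hinc : ∀ c, c = Γ.ter e ∨ c = Γ.ter f → Γ.Inc (Γ.color e) c := by
    rintro c (rfl | rfl)
    · exact inc_ter e
    · exact hcf ▸ inc_ter f
  have hr : ∀ c d, Γ.EdgeRelV e f c d → c = d ∨ (c = Γ.ter e ∧ d = Γ.ter f) := by
    rintro c d (⟨rfl, rfl⟩ | ⟨rfl, rfl⟩)
    · exact .inl hef.ini_eq
    · exact .inr ⟨rfl, rfl⟩
  rcases eq_or_of_quot_mk_eq hr hab with rfl | ⟨ha', hb'⟩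
  · exact .inl (mem_VB_of_ne zero_ne_one ha hb)
  obtain hc | hc : Γ.color e = 0 ∨ Γ.color e = 1 := by omega
  · exact .inr (.inl (mem_VB_of_ne zero_ne_one (hc ▸ hinc b hb') hb))
  · exact .inl (mem_VB_of_ne zero_ne_one ha (hc ▸ hinc a ha'))

theorem conflict_iff (hφ : ∀ i, Function.Injective (φ i)) {a b c : Γ.V} : Conflict φ Γ c a b ↔
    a ≠ b ∧ ∃ x, Γ.HasFactorPath R 0 c (φ 0 x) a ∧ Γ.HasFactorPath R 1 c (φ 1 x) b := by
  refine and_congr_right fun _ => ⟨?_, ?_⟩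
  · rintro ⟨w, w', hw, hw', hA, -, hv⟩
    obtain ⟨g, hg, hgv⟩ := (exists_monoPath_val_eq_of (φ := φ)).1 ⟨w, hw, rfl⟩
    obtain ⟨g', hg', hgv'⟩ := (exists_monoPath_val_eq_of (φ := φ)).1 ⟨w', hw', rfl⟩
    obtain ⟨x, rfl⟩ := (of_mem_amal_iff hφ).1 (hgv ▸ hA)
    have hxg' : φ 1 x = g' := by
      refine PushoutI.of_injective hφ 1 ?_
      rw [hgv', ← hv, ← hgv, PushoutI.of_apply_eq_base, PushoutI.of_apply_eq_base]
    exact ⟨x, hg, hxg' ▸ hg'⟩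
  · rintro ⟨x, h, h'⟩
    obtain ⟨w, hw, hv⟩ := (exists_monoPath_val_eq_of (φ := φ)).2 ⟨_, h, rfl⟩
    obtain ⟨w', hw', hv'⟩ := (exists_monoPath_val_eq_of (φ := φ)).2 ⟨_, h', rfl⟩
    rw [PushoutI.of_apply_eq_base] at hv hv'
    exact ⟨w, w', hw, hw', ⟨x, hv.symm⟩, ⟨x, hv'.symm⟩, hv.trans hv'.symm⟩

theorem VB_identify_subset_biorbit (hφ : ∀ i, Function.Injective (φ i)) {Γ : PGraph X} {B : Set Γ.V}
    (hB : Γ.VB ⊆ biorbit φ Γ.toLGraph B) {a b c : Γ.V} (hc : c ∈ B)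
    (h : Conflict φ Γ.toLGraph c a b) :
    (Γ.identify a b).VB ⊆ biorbit φ (Γ.identify a b).toLGraph (Γ.identifyV a b '' B) := by
  let q := Γ.identVertsHom fun c d => c = a ∧ d = b
  have hab : q.onV a = q.onV b := Quot.sound ⟨rfl, rfl⟩
  refine VB_subset_biorbit_map q Function.surjective_id hB fun a' b' ha' hb' h' => ?_
  rcases eq_or_of_quot_mk_eq (fun _ _ => .inr) h' with rfl | ⟨ha, -⟩
  · exact .inl (mem_VB_of_ne zero_ne_one ha' hb')
  have ha : q.onV a' = q.onV a := by rcases ha with rfl | rfl; exacts [rfl, hab.symm]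
  obtain ⟨-, x, hx₀, hx₁⟩ := (conflict_iff hφ).1 h
  refine .inr (.inr ⟨_, ⟨c, hc, rfl⟩, x, Fin.forall_fin_two.2 ⟨?_, ?_⟩⟩)
  · exact ha ▸ hx₀.map q
  · exact (ha.trans hab) ▸ hx₁.map q

theorem noConflict_of_VB_subset_biorbit (hφ : ∀ i, Function.Injective (φ i)) {B : Set Γ.V}
    (hB : Γ.VB ⊆ biorbit φ Γ B)
    (h : ∀ c ∈ B, ∀ a b, ¬ Conflict φ Γ c a b) : NoConflict φ Γ := by
  have key : ∀ d ∈ Γ.VB, ∀ y a b, Γ.HasFactorPath R 0 d (φ 0 y) a →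
      Γ.HasFactorPath R 1 d (φ 1 y) b → a = b := by
    intro d hd y a b ha hb
    obtain ⟨c, hc, x, hx⟩ := hB hd
    by_contra hab
    refine h c hc a b ((conflict_iff hφ).2 ⟨hab, x * y, ?_, ?_⟩) <;> rw [map_mul]
    · exact (hx 0).trans ha
    · exact (hx 1).trans hb
  intro d hd i j x b c hij hb hc
  obtain ⟨rfl, rfl⟩ | ⟨rfl, rfl⟩ : (i = 0 ∧ j = 1) ∨ (i = 1 ∧ j = 0) := by omega
  · exact key d hd x b c hb hc
  · exact (key d hd x c b hc hb).symm

end Steps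

section Glued

variable {α β : Type*} {s : α → β → Prop} {p q : α ⊕ β}

/-- The relation on a disjoint union generated by `inl a ∼ inr b` for `s a b`, spelled out for a
partial injection `s`. -/
def Glued (s : α → β → Prop) : α ⊕ β → α ⊕ β → Prop
  | .inl a, .inl a' => a = a'
  | .inl a, .inr b => s a b
  | .inr b, .inl a => s a b
  | .inr b, .inr b' => b = b'

theorem equivalence_glued (hl : Relator.LeftUnique s) (hr : Relator.RightUnique s) :
    Equivalence (Glued s) where
  refl := by rintro (a | b) <;> rfl
  symm := by rintro (a | b) (a' | b') h <;> first | exact h | exact h.symm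
  trans := by
    rintro (a | b) (a' | b') (a'' | b'') h h' <;> simp only [Glued] at h h' ⊢
    · exact h.trans h'
    · exact h ▸ h'
    · exact hl h h'
    · exact h' ▸ h
    · exact h' ▸ h
    · exact hr h h'
    · exact h ▸ h'
    · exact h.trans h'

theorem glued_of_quot_mk_eq (hl : Relator.LeftUnique s) (hr : Relator.RightUnique s)
    {r : α ⊕ β → α ⊕ β → Prop} (hrs : ∀ p q, r p q → Glued s p q)
    (h : Quot.mk r p = Quot.mk r q) : Glued s p q :=
  (equivalence_glued hl hr).eqvGen_iff.1 ((Quot.eqvGen_exact h).mono hrs)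

end Glued

/-! ### Gluing a relative Cayley graph at the basepoint -/

section GlueRel

variable {X : Fin 2 → Type u} {R : ∀ i, Set (FreeGroup (X i))} {A : Type v} [Group A]
  {φ : ∀ i, A →* PresentedGroup (R i)} {H : Subgroup (PushoutI φ)} {Γ : PGraph X} {i j : Fin 2}
  {L : Subgroup (PresentedGroup (R j))} {a b : Γ.V} {x : A}

theorem glueRel_iff (hφ : ∀ i, Function.Injective (φ i))
    {c d : (Γ.toLGraph.disjUnion (relCayley L)).V} :
    GlueRel φ Γ i L c d ↔ ∃ x b, Γ.HasFactorPath R i Γ.base (φ i x) b ∧ c = Sum.inl b ∧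
      d = Sum.inr (coset L (φ j x)) := by
  have key (x : A) (b : Γ.V) :
      (∃ w, Γ.HasMonoPath i Γ.base w b ∧ val φ w = PushoutI.base φ x) ↔
        Γ.HasFactorPath R i Γ.base (φ i x) b := by
    simp only [exists_monoPath_val_eq_of, ← PushoutI.of_apply_eq_base φ i,
      (PushoutI.of_injective hφ i).eq_iff, exists_eq_right]
  simp only [GlueRel, ← key]
  constructor
  · rintro ⟨x, b, w, hw, hv, h⟩
    exact ⟨x, b, ⟨w, hw, hv⟩, h⟩
  · rintro ⟨x, b, ⟨w, hw, hv⟩, h⟩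
    exact ⟨x, b, w, hw, hv, h⟩

section Morphisms

variable (φ Γ i L)

/-- The canonical morphism onto `glueRelCayley φ Γ i L` from the disjoint union. -/
def glueRelHom : (Γ.toLGraph.disjUnion (relCayley L)).Hom (glueRelCayley φ Γ i L).toLGraph :=
  (Γ.toLGraph.disjUnion (relCayley L)).identVertsHom (GlueRel φ Γ i L)

/-- The morphism from the original graph to the graph with a relative Cayley graph glued on. -/
def glueRelInl : Γ.Hom (glueRelCayley φ Γ i L).toLGraph :=
  (glueRelHom φ Γ i L).comp (Γ.inlHom (relCayley L))

/-- The morphism from the relative Cayley graph that is glued on. -/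
def glueRelInr : (relCayley L).Hom (glueRelCayley φ Γ i L).toLGraph :=
  (glueRelHom φ Γ i L).comp (Γ.inrHom (relCayley L))

end Morphisms

theorem glueRelInl_eq_glueRelInr (hφ : ∀ i, Function.Injective (φ i))
    (h : Γ.HasFactorPath R i Γ.base (φ i x) b) :
    (glueRelInl φ Γ i L).onV b = (glueRelInr φ Γ i L).onV (coset L (φ j x)) :=
  Quot.sound (r := GlueRel φ Γ i L) ((glueRel_iff hφ).2 ⟨x, b, h, rfl, rfl⟩)

theorem glueRelInl_base (hφ : ∀ i, Function.Injective (φ i)) :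
    (glueRelInl φ Γ i L).onV Γ.base = (glueRelInr φ Γ i L).onV (coset L 1) := by
  rw [glueRelInl_eq_glueRelInr (x := 1) hφ (by rw [map_one]; exact .refl R _ _), map_one]

variable (φ Γ i L) in
theorem glueRelInr_hasFactorPath (g h : PresentedGroup (R j)) :
    (glueRelCayley φ Γ i L).HasFactorPath R j ((glueRelInr φ Γ i L).onV (coset L g)) h
      ((glueRelInr φ Γ i L).onV (coset L (g * h))) :=
  ((cayley_hasFactorPath g h).map (cosetHom L)).map (glueRelInr φ Γ i L)

theorem LGraph.Connected.glueRelCayley (hφ : ∀ i, Function.Injective (φ i)) (hΓ : Γ.Connected) :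
    (glueRelCayley φ Γ i L).Connected := by
  refine connected_of_forall_hasPath ((glueRelInl φ Γ i L).onV Γ.base) ?_
  rintro ⟨a | c⟩
  · obtain ⟨w, hw⟩ := hΓ.2 Γ.base a
    exact ⟨w, hw.map (glueRelInl φ Γ i L)⟩
  · obtain ⟨g, rfl⟩ := coset_surjective L c
    obtain ⟨u, hu, -⟩ := glueRelInr_hasFactorPath φ Γ i L 1 g
    rw [one_mul, ← glueRelInl_base hφ] at hu
    exact ⟨_, hu⟩

variable (φ Γ i L) in
/-- The conditions under which step 6 glues the relative Cayley graph of `L` along the orbit of the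
basepoint: `L` is the nontrivial stabilizer of the basepoint in the amalgamated subgroup, where the
basepoint is read in colour `i`. -/
structure IsGluable : Prop where
  ne : i ≠ j
  mono : Γ.Monochromatic i Γ.base
  inc : Γ.Inc i Γ.base
  le_range : L ≤ (φ j).range
  mem_iff : ∀ x, φ j x ∈ L ↔ Γ.HasFactorPath R i Γ.base (φ i x) Γ.base
  exists_ne_one : ∃ x, φ j x ∈ L ∧ x ≠ 1

theorem NeedsGlue.isGluable (hφ : ∀ i, Function.Injective (φ i)) (hΓ : Cover R Γ.toLGraph)
    {e : Γ.E} {K : Subgroup (PresentedGroup (R (Γ.color e)))} (h : NeedsGlue φ Γ e K)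
    (hj : j ≠ Γ.color e) :
    IsGluable φ Γ (Γ.color e) ((K.comap (φ (Γ.color e))).map (φ j)) := by
  obtain ⟨hm, hK, hne⟩ := h
  obtain ⟨hb, rfl⟩ := hΓ.compIso_iff.1 hK
  obtain ⟨x, hx, hx1⟩ := (Subgroup.bot_or_exists_ne_one _).resolve_left hne
  exact ⟨hj.symm, hm, inc_of_mem_compV hb, Subgroup.map_le_range _ _,
    fun x => Subgroup.mem_map_iff_mem (hφ j), x, ⟨x, hx, rfl⟩, hx1⟩

namespace IsGluable

theorem coset_eq_iff (hd : IsGluable φ Γ i L) {x y : A} :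
    coset L (φ j x) = coset L (φ j y) ↔ Γ.HasFactorPath R i Γ.base (φ i (y * x⁻¹)) Γ.base := by
  rw [Stallings.coset_eq_iff, ← map_inv, ← map_mul, hd.mem_iff]

theorem leftUnique (hd : IsGluable φ Γ i L) (hΓ : Cover R Γ.toLGraph) :
    Relator.LeftUnique fun (a : Γ.V) (c : (relCayley L).V) =>
      ∃ x, Γ.HasFactorPath R i Γ.base (φ i x) a ∧ c = coset L (φ j x) := by
  rintro a b _ ⟨x, hx, rfl⟩ ⟨y, hy, hxy⟩
  have h := (hd.coset_eq_iff.1 hxy).trans hx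
  rw [← map_mul, inv_mul_cancel_right] at h
  exact hΓ.unique h hy

theorem rightUnique (hd : IsGluable φ Γ i L) :
    Relator.RightUnique fun (a : Γ.V) (c : (relCayley L).V) =>
      ∃ x, Γ.HasFactorPath R i Γ.base (φ i x) a ∧ c = coset L (φ j x) := by
  rintro a _ _ ⟨x, hx, rfl⟩ ⟨y, hy, rfl⟩
  rw [hd.coset_eq_iff, map_mul, map_inv]
  exact hy.trans hx.symm

theorem glued (hd : IsGluable φ Γ i L) (hφ : ∀ i, Function.Injective (φ i))
    (hΓ : Cover R Γ.toLGraph) {p q : Γ.V ⊕ (relCayley L).V}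
    (h : Quot.mk (GlueRel φ Γ i L) p = Quot.mk (GlueRel φ Γ i L) q) :
    Glued (fun a c => ∃ x, Γ.HasFactorPath R i Γ.base (φ i x) a ∧ c = coset L (φ j x)) p q := by
  refine glued_of_quot_mk_eq (hd.leftUnique hΓ) hd.rightUnique (fun p q hpq => ?_) h
  obtain ⟨x, b, hb, rfl, rfl⟩ := (glueRel_iff hφ).1 hpq
  exact ⟨x, hb, rfl⟩

theorem inl_injective (hd : IsGluable φ Γ i L) (hφ : ∀ i, Function.Injective (φ i))
    (hΓ : Cover R Γ.toLGraph) : Function.Injective (glueRelInl φ Γ i L).onV :=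
  fun _ _ h => hd.glued hφ hΓ h

theorem inr_injective (hd : IsGluable φ Γ i L) (hφ : ∀ i, Function.Injective (φ i))
    (hΓ : Cover R Γ.toLGraph) : Function.Injective (glueRelInr φ Γ i L).onV :=
  fun _ _ h => hd.glued hφ hΓ h

theorem exists_of_inl_eq_inr (hd : IsGluable φ Γ i L) (hφ : ∀ i, Function.Injective (φ i))
    (hΓ : Cover R Γ.toLGraph) {c : (relCayley L).V}
    (h : (glueRelInl φ Γ i L).onV a = (glueRelInr φ Γ i L).onV c) :
    ∃ x, Γ.HasFactorPath R i Γ.base (φ i x) a ∧ c = coset L (φ j x) :=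
  hd.glued hφ hΓ h

theorem monochromatic (hd : IsGluable φ Γ i L) (hΓ : FoldedPrecover φ Γ.toLGraph)
    (h : Γ.HasFactorPath R i Γ.base (φ i x) a) : Γ.Monochromatic i a := by
  intro f hf
  by_contra hc
  have hback : Γ.HasFactorPath R i a (φ i x⁻¹) Γ.base := by simpa only [map_inv] using h.symm
  have hf' : Γ.Inc (Γ.color f) a := ⟨f, hf, rfl⟩
  obtain ⟨f', hf', hc'⟩ := (hΓ.factorPath_other hf' hback).inc hf'
  exact hc (hc'.symm.trans (hd.mono f' hf'))

theorem lab_ne (hd : IsGluable φ Γ i L) (hφ : ∀ i, Function.Injective (φ i))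
    (hΓ : FoldedPrecover φ Γ.toLGraph) {f : Γ.E} {f' : (relCayley L).E}
    (h : (glueRelInl φ Γ i L).onV (Γ.ini f) = (glueRelInr φ Γ i L).onV ((relCayley L).ini f')) :
    Γ.lab f ≠ (relCayley L).lab f' := by
  obtain ⟨x, hx, -⟩ := hd.exists_of_inl_eq_inr hφ hΓ.cover h
  exact fun hl => hd.ne ((hd.monochromatic hΓ hx f rfl).symm.trans (congrArg Letter.color hl))

theorem cover (hd : IsGluable φ Γ i L) (hφ : ∀ i, Function.Injective (φ i))
    (hΓ : FoldedPrecover φ Γ.toLGraph) : Cover R (glueRelCayley φ Γ i L).toLGraph := by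
  refine .of_exists ?_ ?_
  · rintro (f | f) (f' | f') h h'
    · exact congrArg Sum.inl (hΓ.cover.wellLabelled _ _ (hd.inl_injective hφ hΓ.cover h) h')
    · exact absurd h' (hd.lab_ne hφ hΓ h)
    · exact absurd h'.symm (hd.lab_ne hφ hΓ h.symm)
    · exact congrArg Sum.inr (relCayley_wellLabelled L _ _ (hd.inr_injective hφ hΓ.cover h) h')
  · rintro (f | ⟨c, x⟩)
    · exact ⟨_, ini_mem_compV _,
        (hΓ.cover.isCoveredAt _ _ (inc_ini f)).map (glueRelInl φ Γ i L)⟩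
    · obtain ⟨g, rfl⟩ := coset_surjective L c
      exact ⟨_, ini_mem_compV _, isCoveredAt_onV ((glueRelInr φ Γ i L).comp (cosetHom L)) g⟩

theorem exists_of_mem_VB (hd : IsGluable φ Γ i L) (hφ : ∀ i, Function.Injective (φ i))
    (hΓ : Cover R Γ.toLGraph) {d : (glueRelCayley φ Γ i L).V}
    (h : d ∈ (glueRelCayley φ Γ i L).VB) :
    ∃ a, d = (glueRelInl φ Γ i L).onV a ∧
      (a ∈ Γ.VB ∨ ∃ x, Γ.HasFactorPath R i Γ.base (φ i x) a) := by
  obtain ⟨f | f, rfl, hc⟩ := h i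
  · refine ⟨Γ.ini f, rfl, ?_⟩
    obtain ⟨f' | f', hf', hc'⟩ := h j
    · exact .inl (mem_VB_of_ne hd.ne ⟨f, rfl, hc⟩ ⟨f', hd.inl_injective hφ hΓ hf', hc'⟩)
    · obtain ⟨x, hx, -⟩ := hd.exists_of_inl_eq_inr hφ hΓ hf'.symm
      exact .inr ⟨x, hx⟩
  · exact absurd hc.symm hd.ne

theorem hasFactorPath_of_orbit (hd : IsGluable φ Γ i L) (hφ : ∀ i, Function.Injective (φ i))
    (ha : Γ.HasFactorPath R i Γ.base (φ i x) a) {y : A} (hb : Γ.HasFactorPath R i a (φ i y) b)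
    (k : Fin 2) :
    (glueRelCayley φ Γ i L).HasFactorPath R k ((glueRelInl φ Γ i L).onV a) (φ k y)
      ((glueRelInl φ Γ i L).onV b) := by
  obtain rfl | rfl : k = i ∨ k = j := by have := hd.ne; omega
  · exact hb.map (glueRelInl φ Γ k L)
  · have hab := ha.trans hb
    rw [← map_mul] at hab
    rw [glueRelInl_eq_glueRelInr hφ ha, glueRelInl_eq_glueRelInr hφ hab, map_mul]
    exact glueRelInr_hasFactorPath φ Γ i L _ _

theorem noConflict (hd : IsGluable φ Γ i L) (hφ : ∀ i, Function.Injective (φ i))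
    (hΓ : FoldedPrecover φ Γ.toLGraph) : NoConflict φ (glueRelCayley φ Γ i L).toLGraph := by
  have key (d) (hdV : d ∈ (glueRelCayley φ Γ i L).VB) (x : A) :
      ∃ b, ∀ k, (glueRelCayley φ Γ i L).HasFactorPath R k d (φ k x) b := by
    obtain ⟨a, rfl, ha | ⟨y, hy⟩⟩ := hd.exists_of_mem_VB hφ hΓ.cover hdV
    · obtain ⟨b, hb⟩ := hΓ.cover.exists_factorPath (ha 0) (φ 0 x)
      exact ⟨_, fun k => (hΓ.factorPath_other (ha k) hb).map (glueRelInl φ Γ i L)⟩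
    · obtain ⟨b, hb⟩ := hΓ.cover.exists_factorPath (hy.inc hd.inc) (φ i x)
      exact ⟨_, hd.hasFactorPath_of_orbit hφ hy hb⟩
  intro d hdV k l x b c _ hb hc
  obtain ⟨b', hb'⟩ := key d hdV x
  have hcov := hd.cover hφ hΓ
  exact (hcov.unique hb (hb' k)).trans (hcov.unique (hb' l) hc)

theorem foldedPrecover (hd : IsGluable φ Γ i L) (hφ : ∀ i, Function.Injective (φ i))
    (hΓ : FoldedPrecover φ Γ.toLGraph) : FoldedPrecover φ (glueRelCayley φ Γ i L).toLGraph where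
  cover := hd.cover hφ hΓ
  gBased := (hd.cover hφ hΓ).gBased hφ (hd.noConflict hφ hΓ)
  connected := hΓ.connected.glueRelCayley hφ

theorem exists_factorPath_base (hd : IsGluable φ Γ i L) (hφ : ∀ i, Function.Injective (φ i)) :
    ∃ x, x ≠ 1 ∧ ∀ k, (glueRelCayley φ Γ i L).HasFactorPath R k
      (glueRelCayley φ Γ i L).base (φ k x) (glueRelCayley φ Γ i L).base := by
  obtain ⟨x, hx, hx1⟩ := hd.exists_ne_one
  refine ⟨x, hx1, hd.hasFactorPath_of_orbit (x := 1) hφ ?_ ((hd.mem_iff x).1 hx)⟩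
  rw [map_one]
  exact .refl R i Γ.base

theorem base_mem_VB (hd : IsGluable φ Γ i L) (hφ : ∀ i, Function.Injective (φ i)) :
    (glueRelCayley φ Γ i L).base ∈ (glueRelCayley φ Γ i L).VB := by
  obtain ⟨x, hx, h⟩ := hd.exists_factorPath_base hφ
  exact fun k => (h k).inc_of_ne_one ((map_ne_one_iff _ (hφ k)).2 hx)

theorem stab_ne_bot (hd : IsGluable φ Γ i L) (hφ : ∀ i, Function.Injective (φ i))
    {f : (glueRelCayley φ Γ i L).E} {t : (glueRelCayley φ Γ i L).V}
    (ht : t ∈ (glueRelCayley φ Γ i L).compV f)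
    (hb : (glueRelCayley φ Γ i L).base ∈ (glueRelCayley φ Γ i L).compV f) :
    (glueRelCayley φ Γ i L).stab R ((glueRelCayley φ Γ i L).color f) t ≠ ⊥ := by
  obtain ⟨x, hx, h⟩ := hd.exists_factorPath_base hφ
  obtain ⟨g, hg⟩ := exists_factorPath_of_mem_compV R ht hb
  intro hbot
  have hconj := (Subgroup.eq_bot_iff_forall _).1 hbot _ ((hg.trans (h _)).trans hg.symm)
  exact (map_ne_one_iff _ (hφ _)).2 hx (conj_eq_one_iff.1 hconj)

theorem hasFactorPath_inl_iff (hd : IsGluable φ Γ i L) (hφ : ∀ i, Function.Injective (φ i))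
    (hΓ : FoldedPrecover φ Γ.toLGraph) {k : Fin 2} {g : PresentedGroup (R k)}
    (ha : Γ.Inc k a) :
    (glueRelCayley φ Γ i L).HasFactorPath R k ((glueRelInl φ Γ i L).onV a) g
      ((glueRelInl φ Γ i L).onV b) ↔ Γ.HasFactorPath R k a g b := by
  refine ⟨fun h => ?_, .map (glueRelInl φ Γ i L)⟩
  obtain ⟨c, hc⟩ := hΓ.cover.exists_factorPath ha g
  have hbc := (hd.cover hφ hΓ).unique h (hc.map (glueRelInl φ Γ i L))
  rwa [hd.inl_injective hφ hΓ.cover hbc]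

theorem compVB_inl (hd : IsGluable φ Γ i L) (hφ : ∀ i, Function.Injective (φ i))
    (hΓ : FoldedPrecover φ Γ.toLGraph) {f : Γ.E} (hb : Γ.base ∉ Γ.compV f) :
    (glueRelCayley φ Γ i L).compVB ((glueRelInl φ Γ i L).onE f) =
      (glueRelInl φ Γ i L).onV '' Γ.compVB f := by
  refine Set.Subset.antisymm ?_ ?_
  · rintro d ⟨hdf, hdV⟩
    obtain ⟨a, rfl, ha⟩ := hd.exists_of_mem_VB hφ hΓ.cover hdV
    obtain ⟨g, hg⟩ := (mem_compV_iff R).1 hdf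
    have haf : a ∈ Γ.compV f :=
      (mem_compV_iff R).2 ⟨g, (hd.hasFactorPath_inl_iff hφ hΓ (inc_ini f)).1 hg⟩
    refine ⟨a, ⟨haf, ha.resolve_right ?_⟩, rfl⟩
    rintro ⟨x, hx⟩
    obtain ⟨f', hf', hc⟩ := inc_of_mem_compV haf
    obtain rfl : i = Γ.color f := (hd.monochromatic hΓ hx f' hf').symm.trans hc
    exact hb (hx.symm.mem_compV haf)
  · rintro _ ⟨a, ha, rfl⟩
    exact ⟨mem_compV_map (glueRelInl φ Γ i L) ha.1,
      fun k => Inc.map (glueRelInl φ Γ i L) (ha.2 k)⟩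

theorem base_mem_compV_inr (hφ : ∀ i, Function.Injective (φ i)) (f : (relCayley L).E) :
    (glueRelCayley φ Γ i L).base ∈
      (glueRelCayley φ Γ i L).compV ((glueRelInr φ Γ i L).onE f) := by
  obtain ⟨g, hg⟩ := coset_surjective L f.1
  have h := glueRelInr_hasFactorPath φ Γ i L g g⁻¹
  rw [mul_inv_cancel, ← glueRelInl_base hφ, hg] at h
  exact (mem_compV_iff R).2 ⟨_, h⟩

theorem removable_of_inl (hd : IsGluable φ Γ i L) (hφ : ∀ i, Function.Injective (φ i))
    (hΓ : FoldedPrecover φ Γ.toLGraph) {f : Γ.E} {t : (glueRelCayley φ Γ i L).V}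
    (ht : t ∈ (glueRelCayley φ Γ i L).compVB ((glueRelInl φ Γ i L).onE f))
    (hs : monoLab φ (glueRelCayley φ Γ i L).toLGraph (Γ.color f) t ⊆ amal φ)
    (ho : (glueRelCayley φ Γ i L).compVB ((glueRelInl φ Γ i L).onE f) =
      orbit φ (glueRelCayley φ Γ i L).toLGraph (Γ.color f) t)
    (hb : Γ.base ∉ Γ.compV f) : Removable φ Γ f := by
  rw [hd.compVB_inl hφ hΓ hb] at ht ho
  obtain ⟨a, ha, rfl⟩ := ht
  refine hΓ.removable hφ ha (fun g hg => ?_) ?_ (.inl hb)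
  · exact (monoLab_subset_amal_iff hφ).1 hs (hg.map (glueRelInl φ Γ i L))
  · refine Set.Subset.antisymm (fun b hb => ?_) (hΓ.orbit_subset_compVB hφ ha)
    obtain ⟨x, hx⟩ := (mem_orbit hφ).1 (ho ▸ Set.mem_image_of_mem _ hb)
    exact (mem_orbit hφ).2 ⟨x, (hd.hasFactorPath_inl_iff hφ hΓ (ha.2 _)).1 hx⟩

theorem not_redundant (hd : IsGluable φ Γ i L) (hφ : ∀ i, Function.Injective (φ i))
    (hΓ : FoldedPrecover φ Γ.toLGraph) (hr : ∀ f, ¬ Removable φ Γ f)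
    (f : (glueRelCayley φ Γ i L).E) : ¬ Redundant φ (glueRelCayley φ Γ i L) f := by
  rintro (⟨h, -⟩ | ⟨-, t, ht, hs, ho, hbase | ⟨hbase, h1⟩⟩)
  · obtain ⟨f', -, hf'⟩ := hd.base_mem_VB hφ (1 - (glueRelCayley φ Γ i L).color f)
    have := (h f').1
    omega
  · obtain f | f := f
    · exact hr f (hd.removable_of_inl hφ hΓ ht hs ho
        fun h => hbase (mem_compV_map (glueRelInl φ Γ i L) h))
    · exact hbase (base_mem_compV_inr hφ f)
  · exact hd.stab_ne_bot hφ ht.1 hbase.1 ((monoLab_eq_one_iff hφ).1 h1)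

theorem isReducedPrecover (hd : IsGluable φ Γ i L) (hφ : ∀ i, Function.Injective (φ i))
    (hΓ : FoldedPrecover φ Γ.toLGraph) (hr : ∀ f, ¬ Removable φ Γ f) :
    IsReducedPrecover φ (glueRelCayley φ Γ i L) where
  precover := (hd.foldedPrecover hφ hΓ).isPrecover
  not_redundant := hd.not_redundant hφ hΓ hr
  base_cond _ _ _ :=
    (hd.foldedPrecover hφ hΓ).exists_other_component hφ (hd.base_mem_VB hφ) _

theorem exists_potential (hd : IsGluable φ Γ i L) (hφ : ∀ i, Function.Injective (φ i))
    {p : Γ.V → PushoutI φ ⧸ H} (hp : IsPotential φ H Γ.toLGraph p) :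
    ∃ q, IsPotential φ H (glueRelCayley φ Γ i L).toLGraph q ∧
      ∀ a, q ((glueRelInl φ Γ i L).onV a) = p a := by
  have hL {g h : PresentedGroup (R j)} (hgh : h * g⁻¹ ∈ L) :
      (PushoutI.of (φ := φ) j g)⁻¹ • p Γ.base = (PushoutI.of (φ := φ) j h)⁻¹ • p Γ.base := by
    obtain ⟨x, hx⟩ := hd.le_range hgh
    have hbase := hp.eq_of_smul ((hd.mem_iff x).1 (hx ▸ hgh))
    rw [PushoutI.of_apply_eq_base, ← PushoutI.of_apply_eq_base φ j, hx, map_mul, map_inv,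
      mul_smul] at hbase
    rw [eq_inv_smul_iff, ← hbase]
  let q : (relCayley L).V → PushoutI φ ⧸ H :=
    Quotient.lift (fun g => (PushoutI.of (φ := φ) j g)⁻¹ • p Γ.base)
      fun _ _ h => hL (QuotientGroup.rightRel_apply.1 h)
  have hq (g) : q (coset L g) = (PushoutI.of (φ := φ) j g)⁻¹ • p Γ.base := rfl
  refine ⟨Quot.lift (Sum.elim p q) ?_, ?_, fun _ => rfl⟩
  · intro c d hcd
    obtain ⟨x, b, hx, rfl, rfl⟩ := (glueRel_iff hφ).1 hcd
    change p b = q (coset L (φ j x))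
    rw [hq, hp.eq_of_smul hx, PushoutI.of_apply_eq_base, PushoutI.of_apply_eq_base, inv_smul_smul]
  · rintro (f | ⟨c, x⟩)
    · exact hp f
    · obtain ⟨g, rfl⟩ := coset_surjective L c
      change q (coset L g) = val φ [letter j x] • q (coset L (g * genVal R x))
      rw [hq, hq, val_letter, smul_smul, map_mul, mul_inv_rev, mul_inv_cancel_left]

theorem sound [∀ i, Finite (X i)] [∀ i, Finite (PresentedGroup (R i))]
    (hd : IsGluable φ Γ i L) (hφ : ∀ i, Function.Injective (φ i)) (h : Sound φ H Γ) :
    Sound φ H (glueRelCayley φ Γ i L) where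
  finite_V :=
    have := h.finite_V
    have : Finite (Γ.disjUnion (relCayley L)).V :=
      inferInstanceAs (Finite (Γ.V ⊕ Quotient (QuotientGroup.rightRel L)))
    .of_surjective (glueRelHom φ Γ i L).onV Quot.mk_surjective
  finite_E :=
    have := h.finite_E
    inferInstanceAs (Finite (Γ.E ⊕ Quotient (QuotientGroup.rightRel L) × (X j × Bool)))
  connected := h.connected.glueRelCayley hφ
  subset_lab := h.subset_lab.trans (Lab.map (glueRelInl φ Γ i L) rfl)
  exists_potential := by
    obtain ⟨p, hp, hp1⟩ := h.exists_potential
    obtain ⟨q, hq, hqp⟩ := hd.exists_potential hφ hp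
    exact ⟨q, hq, (hqp Γ.base).trans hp1⟩

end IsGluable

end GlueRel

/-! ### Executions of the algorithm -/

section Execution

variable {X : Fin 2 → Type u} {R : ∀ i, Set (FreeGroup (X i))} {A : Type v} [Group A]
  {φ : ∀ i, A →* PresentedGroup (R i)} {Γ : PGraph X}

theorem FoldedPrecover.isCayley (hΓ : FoldedPrecover φ Γ.toLGraph) {e : Γ.E}
    (he : ∀ f, Γ.color f = Γ.color e) (hs : Γ.stab R (Γ.color e) Γ.base = ⊥) : IsCayley R Γ := by
  obtain ⟨w, hw⟩ := hΓ.connected.2 (Γ.ini e) Γ.base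
  refine ⟨Set.eq_empty_of_forall_notMem fun a ha => ?_, Γ.color e,
    hΓ.cover.exists_iso_cayley hΓ.connected he ((hw.hasMonoPath he).inc (inc_ini e)) hs⟩
  obtain ⟨f, -, hf⟩ := ha (1 - Γ.color e)
  have := he f
  omega

theorem FoldedPrecover.not_redundant (hφ : ∀ i, Function.Injective (φ i))
    (hΓ : FoldedPrecover φ Γ.toLGraph) (hr : ∀ e, ¬ Removable φ Γ e)
    (hc : IsCayley R Γ → IsEmpty Γ.E) (e : Γ.E) : ¬ Redundant φ Γ e := by
  rintro (⟨h, hs⟩ | ⟨-, t, ht, hs, ho, hb⟩)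
  · exact (hc (hΓ.isCayley (fun f => (h f).1) ((monoLab_eq_one_iff hφ).1 hs))).false e
  · exact hr e (hΓ.removable hφ ht ((monoLab_subset_amal_iff hφ).1 hs) ho
      (hb.imp_right (And.imp_right (monoLab_eq_one_iff hφ).1)))

theorem monoLab_inter_amal_eq_one (hφ : ∀ i, Function.Injective (φ i)) {i : Fin 2} {a : Γ.V}
    (h : (Γ.stab R i a).comap (φ i) = ⊥) : monoLab φ Γ.toLGraph i a ∩ amal φ = {1} := by
  refine Set.Subset.antisymm ?_ ?_
  · rintro z ⟨hz, hza⟩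
    obtain ⟨g, hg, rfl⟩ := mem_monoLab.1 hz
    obtain ⟨x, rfl⟩ := (of_mem_amal_iff hφ).1 hza
    rw [(Subgroup.eq_bot_iff_forall _).1 h x hg, map_one, map_one, Set.mem_singleton_iff]
  · rintro _ rfl
    exact ⟨mem_monoLab.2 ⟨1, one_mem _, map_one _⟩, 1, map_one _⟩

theorem FoldedPrecover.isReducedPrecover (hφ : ∀ i, Function.Injective (φ i))
    (hΓ : FoldedPrecover φ Γ.toLGraph) (hr : ∀ e, ¬ Removable φ Γ e)
    (hc : IsCayley R Γ → IsEmpty Γ.E)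
    (hg : ∀ e (K : Subgroup (PresentedGroup (R (Γ.color e)))), ¬ NeedsGlue φ Γ e K) :
    IsReducedPrecover φ Γ where
  precover := hΓ.isPrecover
  not_redundant := hΓ.not_redundant hφ hr hc
  base_cond e he hne := by
    refine hΓ.exists_other_component hφ ?_ _
    have hm : ¬ Γ.Monochromatic (Γ.color e) Γ.base := fun hm =>
      hg e _ ⟨hm, hΓ.cover.compIso_stab he, fun h => hne (monoLab_inter_amal_eq_one hφ h)⟩
    simp only [LGraph.Monochromatic, not_forall] at hm
    obtain ⟨f, hf, hfe⟩ := hm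
    exact mem_VB_of_ne hfe ⟨f, hf, rfl⟩ (inc_of_mem_compV he)

theorem exists_picksEdges (Γ : LGraph X) [Finite Γ.E] : ∃ L, PicksEdges Γ L := by
  let s : Setoid Γ.E :=
    ⟨fun e f => f ∈ Γ.compE e, Γ.self_mem_compE, mem_compE_symm,
      fun h h' => compE_subset_of_mem_compE h h'⟩
  have hs (q : Quotient s) (e : Γ.E) : q.out ∈ Γ.compE e ↔ Quotient.mk s e = q :=
    (Quotient.mk_eq_iff_out (s := s)).symm
  have := Fintype.ofFinite (Quotient s)
  have hnodup : ((Finset.univ : Finset (Quotient s)).toList).Nodup := Finset.nodup_toList _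
  refine ⟨Finset.univ.toList.map (Quotient.out (s := s)), fun e => ?_⟩
  obtain ⟨k, hk⟩ := List.get_of_mem (Finset.mem_toList.2 (Finset.mem_univ (Quotient.mk s e)))
  refine ⟨Fin.cast (List.length_map _).symm k, ?_, fun l hl => ?_⟩
  · simp only [List.get_eq_getElem, List.getElem_map, Fin.val_cast]
    exact (hs _ e).2 hk.symm
  · simp only [List.get_eq_getElem, List.getElem_map] at hl
    exact Fin.ext (hnodup.getElem_inj_iff.1 (((hs _ e).1 hl).symm.trans hk.symm))

variable {H : Subgroup (PushoutI φ)}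

variable (φ H) in
/-- The property of a configuration that is preserved by the transitions: its graph determines `H`
and satisfies what the completed steps have established. -/
def Config.Invariant : Config X → Prop
  | .step2 Γ => Sound φ H Γ
  | .step3 Γ L => Sound φ H Γ ∧ CoveredOrListed R Γ.toLGraph L
  | .step4 Γ B => Sound φ H Γ ∧ CoveredOrListed R Γ.toLGraph [] ∧ Γ.VB ⊆ biorbit φ Γ.toLGraph B
  | .step5 Γ => Sound φ H Γ ∧ FoldedPrecover φ Γ.toLGraph
  | .step6 Γ => Sound φ H Γ ∧ FoldedPrecover φ Γ.toLGraph ∧ (∀ e, ¬ Removable φ Γ e) ∧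
      (IsCayley R Γ → IsEmpty Γ.E)
  | .output Γ => Sound φ H Γ ∧ IsReducedPrecover φ Γ

theorem Transition.invariant [∀ i, Finite (X i)] [∀ i, Finite (PresentedGroup (R i))]
    (hφ : ∀ i, Function.Injective (φ i)) {c c' : Config X} (h : Transition φ c c')
    (hc : c.Invariant φ H) : c'.Invariant φ H := by
  cases h with
  | fold2 Γ e f h => exact Sound.fold hc h
  | cut2 Γ e h => exact Sound.cutHair h hc
  | end2 Γ hw hh L hL => exact ⟨hc, .of_picksEdges hL⟩
  | fold3 Γ L e f h =>
    exact ⟨hc.1.fold h, hc.2.map (Γ.identEdgesHom e f h.lab_eq) Quot.mk_surjective⟩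
  | glue3 Γ e L hw => exact ⟨hc.1.glueCayley e, hc.2.glueCayley⟩
  | end3 Γ hw => exact ⟨hc.1, hc.2, subset_biorbit _⟩
  | fold4 Γ B e f h =>
    exact ⟨hc.1.fold h, hc.2.1.map (Γ.identEdgesHom e f h.lab_eq) Quot.mk_surjective,
      VB_fold_subset_biorbit hc.2.2 h⟩
  | identify4 Γ B c a b hcB h =>
    exact ⟨hc.1.identify h, hc.2.1.map (Γ.identVertsHom _) Function.surjective_id,
      VB_identify_subset_biorbit hφ hc.2.2 hcB h⟩
  | end4 Γ B hw h =>
    have hcov := hc.2.1.cover hw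
    exact ⟨hc.1, hcov, hcov.gBased hφ (noConflict_of_VB_subset_biorbit hφ hc.2.2 h),
      hc.1.connected⟩
  | remove5 Γ e h =>
    have hs := hc.1.removeComp (h.base_notMem φ) hφ hc.2 h
    exact ⟨hs, hc.2.removeComp _ hs.connected⟩
  | collapse5 Γ h hcay =>
    exact ⟨hc.1.trivial hcay, trivial_foldedPrecover φ, fun e => e.elim,
      fun _ => inferInstanceAs (IsEmpty PEmpty)⟩
  | end5 Γ h hcay => exact ⟨hc.1, hc.2, h, fun h => absurd h hcay⟩
  | glue6 Γ e K h j hj =>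
    have hd := h.isGluable hφ hc.2.1.cover hj
    exact ⟨hd.sound hφ hc.1, hd.isReducedPrecover hφ hc.2.1 hc.2.2.1⟩
  | end6 Γ h => exact ⟨hc.1, hc.2.1.isReducedPrecover hφ hc.2.2.1 hc.2.2.2 h⟩

theorem Reachable.invariant [∀ i, Finite (X i)] [∀ i, Finite (PresentedGroup (R i))]
    (hφ : ∀ i, Function.Injective (φ i)) {ws : List (List (Letter X))} {c : Config X}
    (h : Reachable φ ws c) :
    c.Invariant φ (Subgroup.closure {g | ∃ w ∈ ws, val φ w = g}) := by
  induction h with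
  | refl => exact sound_bouquet φ ws
  | tail _ h ih => exact h.invariant hφ ih

theorem PGraph.exists_foldable (h : ¬ Γ.WellLabelled) : ∃ e f, Γ.Foldable e f := by
  simp only [LGraph.WellLabelled, not_forall] at h
  obtain ⟨e, f, hini, hlab, hne⟩ := h
  exact ⟨e, f, hne, hini, hlab⟩

variable (φ)

theorem exists_transition_step2 (Γ : PGraph X) [Finite Γ.E] :
    ∃ c, Transition φ (.step2 Γ) c := by
  by_cases hw : Γ.WellLabelled
  · by_cases hh : ∃ e, Γ.IsHair e
    · exact hh.elim fun e h => ⟨_, .cut2 Γ e h⟩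
    · obtain ⟨L, hL⟩ := exists_picksEdges Γ.toLGraph
      exact ⟨_, .end2 Γ hw (not_exists.1 hh) L hL⟩
  · obtain ⟨e, f, h⟩ := PGraph.exists_foldable hw
    exact ⟨_, .fold2 Γ e f h⟩

theorem exists_transition_step3 (Γ : PGraph X) (L : List Γ.E) :
    ∃ c, Transition φ (.step3 Γ L) c := by
  by_cases hw : Γ.WellLabelled
  · cases L with
    | nil => exact ⟨_, .end3 Γ hw⟩
    | cons e L => exact ⟨_, .glue3 Γ e L hw⟩
  · obtain ⟨e, f, h⟩ := PGraph.exists_foldable hw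
    exact ⟨_, .fold3 Γ L e f h⟩

theorem exists_transition_step4 (Γ : PGraph X) (B : Set Γ.V) :
    ∃ c, Transition φ (.step4 Γ B) c := by
  by_cases hw : Γ.WellLabelled
  · by_cases h : ∃ c ∈ B, ∃ a b, Conflict φ Γ.toLGraph c a b
    · obtain ⟨c, hc, a, b, h⟩ := h
      exact ⟨_, .identify4 Γ B c a b hc h⟩
    · exact ⟨_, .end4 Γ B hw fun c hc a b hab => h ⟨c, hc, a, b, hab⟩⟩
  · obtain ⟨e, f, h⟩ := PGraph.exists_foldable hw
    exact ⟨_, .fold4 Γ B e f h⟩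

theorem exists_transition_step5 (Γ : PGraph X) : ∃ c, Transition φ (.step5 Γ) c := by
  by_cases hr : ∃ e, Removable φ Γ e
  · exact hr.elim fun e h => ⟨_, .remove5 Γ e h⟩
  · by_cases hc : IsCayley R Γ
    · exact ⟨_, .collapse5 Γ (not_exists.1 hr) hc⟩
    · exact ⟨_, .end5 Γ (not_exists.1 hr) hc⟩

theorem exists_transition_step6 (Γ : PGraph X) : ∃ c, Transition φ (.step6 Γ) c := by
  by_cases h : ∃ e, ∃ K : Subgroup (PresentedGroup (R (Γ.color e))), NeedsGlue φ Γ e K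
  · obtain ⟨e, K, h⟩ := h
    exact ⟨_, .glue6 Γ e K h (1 - Γ.color e) (by omega)⟩
  · exact ⟨_, .end6 Γ fun e K hK => h ⟨e, K, hK⟩⟩

variable {φ}

theorem Config.Invariant.eq_output_or_exists_transition {c : Config X} (hc : c.Invariant φ H) :
    (∃ Γ, c = .output Γ) ∨ ∃ c', Transition φ c c' := by
  cases c with
  | step2 Γ =>
    have := Sound.finite_E hc
    exact .inr (exists_transition_step2 φ Γ)
  | step3 Γ L => exact .inr (exists_transition_step3 φ Γ L)
  | step4 Γ B => exact .inr (exists_transition_step4 φ Γ B)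
  | step5 Γ => exact .inr (exists_transition_step5 φ Γ)
  | step6 Γ => exact .inr (exists_transition_step6 φ Γ)
  | output Γ => exact .inl ⟨Γ, rfl⟩

theorem card_quot_lt {α : Type*} [Finite α] {r : α → α → Prop} {a b : α} (h : r a b)
    (hab : a ≠ b) : Nat.card (Quot r) < Nat.card α := by
  refine lt_of_le_of_ne (Nat.card_le_card_of_surjective _ Quot.mk_surjective) fun hc => hab ?_
  have hmk : Function.Bijective (Quot.mk r) :=
    (Nat.bijective_iff_surjective_and_card _).2 ⟨Quot.mk_surjective, hc.symm⟩
  exact hmk.1 (Quot.sound h)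

namespace PGraph

/-- The number of vertices plus the number of edges, the measure that decreases within a step;
an edge and its reverse are counted separately. -/
noncomputable def size (Γ : PGraph X) : ℕ := Nat.card Γ.V + Nat.card Γ.E

variable [Finite Γ.V]

theorem size_identify_lt {a b : Γ.V} (hab : a ≠ b) : (Γ.identify a b).size < Γ.size :=
  Nat.add_lt_add_of_lt_of_le (card_quot_lt ⟨rfl, rfl⟩ hab) le_rfl

variable [Finite Γ.E] {e : Γ.E}

theorem size_fold_lt {f : Γ.E} (hef : Γ.Foldable e f) : (Γ.fold e f hef).size < Γ.size :=
  Nat.add_lt_add_of_le_of_lt (Nat.card_le_card_of_surjective _ Quot.mk_surjective)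
    (card_quot_lt (Or.inl ⟨rfl, rfl⟩) hef.ne)

theorem size_cutHair_lt (he : Γ.IsHair e) : (Γ.cutHair e he).size < Γ.size :=
  Nat.add_lt_add_of_lt_of_le (Finite.card_subtype_lt (x := Γ.ter e) fun h => h rfl)
    (Finite.card_subtype_le _)

theorem size_removeComp_lt (he : Γ.base ∉ Γ.compVM e) : (Γ.removeComp e he).size < Γ.size :=
  Nat.add_lt_add_of_le_of_lt (Finite.card_subtype_le _)
    (Finite.card_subtype_lt (x := e) fun h => h (Γ.self_mem_compE e))

end PGraph

/-- The termination measure: the steps that remain, then the gluings of step 3 that remain, then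
the size of the graph. -/
noncomputable def Config.rank : Config X → ℕ ×ₗ ℕ ×ₗ ℕ
  | .step2 Γ => toLex (5, toLex (0, Γ.size))
  | .step3 Γ L => toLex (4, toLex (L.length, Γ.size))
  | .step4 Γ _ => toLex (3, toLex (0, Γ.size))
  | .step5 Γ => toLex (2, toLex (0, Γ.size))
  | .step6 Γ => toLex (1, toLex (0, Γ.size))
  | .output Γ => toLex (0, toLex (0, Γ.size))

theorem Transition.rank_lt {c c' : Config X} (h : Transition φ c c')
    (hc : c.Invariant φ H) : c'.rank < c.rank := by
  have step {a b : ℕ} {x y : ℕ ×ₗ ℕ} (h : a < b) : toLex (a, x) < toLex (b, y) :=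
    Prod.Lex.toLex_lt_toLex.2 (.inl h)
  have size {a b : ℕ} {Γ Δ : PGraph X} (hs : Sound φ H Γ)
      (h : ∀ [Finite Γ.V] [Finite Γ.E], Δ.size < Γ.size) :
      toLex (a, toLex (b, Δ.size)) < toLex (a, toLex (b, Γ.size)) :=
    have := hs.finite_V
    have := hs.finite_E
    Prod.Lex.toLex_lt_toLex.2 (.inr ⟨rfl, Prod.Lex.toLex_lt_toLex.2 (.inr ⟨rfl, h⟩)⟩)
  cases h with
  | fold2 Γ e f h => exact size hc (PGraph.size_fold_lt h)
  | cut2 Γ e h => exact size hc (PGraph.size_cutHair_lt h)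
  | fold3 Γ L e f h =>
    simp only [Config.rank, List.length_map]
    exact size hc.1 (PGraph.size_fold_lt h)
  | glue3 Γ e L hw =>
    exact Prod.Lex.toLex_lt_toLex.2 (.inr ⟨rfl, Prod.Lex.toLex_lt_toLex.2 (.inl (by simp))⟩)
  | fold4 Γ B e f h => exact size hc.1 (PGraph.size_fold_lt h)
  | identify4 Γ B c a b hcB h => exact size hc.1 (PGraph.size_identify_lt h.1)
  | remove5 Γ e h => exact size hc.1 (PGraph.size_removeComp_lt _)
  | _ => exact step (by decide)

theorem not_exists_infinite_execution [∀ i, Finite (X i)] [∀ i, Finite (PresentedGroup (R i))]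
    (hφ : ∀ i, Function.Injective (φ i)) (ws : List (List (Letter X))) :
    ¬ ∃ c : ℕ → Config X, c 0 = .start ws ∧ ∀ n, Transition φ (c n) (c (n + 1)) := by
  rintro ⟨c, h0, hc⟩
  have hr (n : ℕ) : Reachable φ ws (c n) := by
    induction n with
    | zero => exact h0 ▸ .refl
    | succ n ih => exact ih.tail (hc n)
  exact (RelEmbedding.natGT (r := (· < ·)) (fun n => (c n).rank)
    fun n => (hc n).rank_lt ((hr n).invariant hφ)).not_wellFounded wellFounded_lt

end Execution

end Stallings

theorem mainTheorem8_general {X : Fin 2 → Type u} [∀ i, Finite (X i)]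
    (R : ∀ i, Set (FreeGroup (X i))) [∀ i, Finite (PresentedGroup (R i))]
    {A : Type v} [Group A] (φ : ∀ i, A →* PresentedGroup (R i))
    (hφ : ∀ i, Function.Injective (φ i))
    (ws : List (List (Stallings.Letter X))) :
    (¬ ∃ c : ℕ → Stallings.Config X, c 0 = Stallings.Config.start ws ∧
      ∀ n, Stallings.Transition φ (c n) (c (n + 1))) ∧
    (∀ c, Stallings.Reachable φ ws c →
      (∃ Γ, c = .output Γ) ∨ ∃ c', Stallings.Transition φ c c') ∧
    (∀ Γ : Stallings.PGraph X, Stallings.Reachable φ ws (.output Γ) →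
      Finite Γ.V ∧ Finite Γ.E ∧ Stallings.IsReducedPrecover φ Γ ∧
      Stallings.Lab φ Γ =
        (Subgroup.closure {g | ∃ w ∈ ws, Stallings.val φ w = g} :
          Set (Monoid.PushoutI φ))) := by
  refine ⟨Stallings.not_exists_infinite_execution hφ ws,
    fun c hc => (hc.invariant hφ).eq_output_or_exists_transition, fun Γ hΓ => ?_⟩
  obtain ⟨hs, hr⟩ := hΓ.invariant hφ
  exact ⟨hs.finite_V, hs.finite_E, hr, hs.lab_eq⟩

theorem mainTheorem8 {X : Fin 2 → Type u} [∀ i, Finite (X i)]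
    (R : ∀ i, Set (FreeGroup (X i))) (hR : ∀ i, (R i).Finite)
    [∀ i, Finite (PresentedGroup (R i))]
    {A : Type v} [Group A] (φ : ∀ i, A →* PresentedGroup (R i))
    (hφ : ∀ i, Function.Injective (φ i))
    (ws : List (List (Stallings.Letter X))) :
    -- every execution is finite
    (¬ ∃ c : ℕ → Stallings.Config X, c 0 = Stallings.Config.start ws ∧
      ∀ n, Stallings.Transition φ (c n) (c (n + 1))) ∧
    -- no execution gets stuck before it has produced an output
    (∀ c, Stallings.Reachable φ ws c →
      (∃ Γ, c = .output Γ) ∨ ∃ c', Stallings.Transition φ c c') ∧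
    -- every output is a finite reduced precover that determines the subgroup `H` generated by
    -- the input
    (∀ Γ : Stallings.PGraph X, Stallings.Reachable φ ws (.output Γ) →
      Finite Γ.V ∧ Finite Γ.E ∧ Stallings.IsReducedPrecover φ Γ ∧
      Stallings.Lab φ Γ =
        (Subgroup.closure {g | ∃ w ∈ ws, Stallings.val φ w = g} :
          Set (Monoid.PushoutI φ))) :=
  mainTheorem8_general R φ hφ ws
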